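/- Let $\Lambda$ be a quantum channel (completely positive trace-preserving linear map) from the operators on a finite-dimensional Hilbert space $\mathcal H_A$ to themselves. For a finite-dimensional system $B$, a state $\rho^{AB}$ and LOCC channels $F_1,F_2,\dots$ on $AB$ (finite compositions of one-way LOCC steps, in each of which one party applies a quantum instrument and communicates its outcome to the other party, who applies a channel depending on that outcome), put $$\Lambda_n[\rho^{AB}]=(\Lambda\otimes\mathbb 1)\circ F_n\circ\cdots\circ(\Lambda\otimes\mathbb 1)\circ F_1[\rho^{AB}].$$ Let $E_{\mathrm f}$ be the entanglement of formation: $E_{\mathrm f}(\rho^{AB})$ is the minimum of $\sum_i p_i\,S(\mathrm{Tr}_B|\psi_i\rangle\langle\psi_i|)$ over all finite ensembles of pure states with $\rho^{AB}=\sum_i p_i|\psi_i\rangle\langle\psi_i|$, where $S(\sigma)=-\mathrm{Tr}(\sigma\log_2\sigma)$. Then the following are equivalent. (a) There are a finite-dimensional system $B$, a state $\rho^{AB}$ and LOCC channels $F_i$ on $AB$ such that $\lim_{n\to\infty}E_{\mathrm f}(\Lambda_n[\rho^{AB}])$ exists and is strictly positive. (a') The same as (a), with filters that may change Bob's system: there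 are finite-dimensional systems $B_0,B_1,\dots$, a state $\rho^{AB_0}$ and LOCC channels $F_i$ from $AB_{i-1}$ to $AB_i$ such that $\lim_{n\to\infty}E_{\mathrm f}(\Lambda_n[\rho^{AB_0}])$ exists and is strictly positive. (Thus Bob may keep a growing record of earlier measurement outcomes, on which later filters may depend.) (b) $\Lambda$ has a correctable subspace: there are a subspace $\mathcal H_c\subseteq\mathcal H_A$ with $\dim\mathcal H_c\ge 2$ and a quantum channel $\mathcal R$ on the operators on $\mathcal H_A$ such that $\mathcal R\circ\Lambda[|\psi\rangle\langle\psi|]=|\psi\rangle\langle\psi|$ for all $|\psi\rangle\in\mathcal H_c$. -/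

import Mathlib

open Filter Topology
open scoped ComplexOrder

noncomputable section

namespace QInfo

/-- Operators on the finite-dimensional Hilbert space `ℂ^α`, as matrices in the standard basis. -/
abbrev Op (α : Type*) := Matrix α α ℂ

/-- `Φ ⊗ 𝟙`, for a linear map `Φ` acting on the operators of the first tensor factor:
`Φ` is applied to every block `X (·, j) (·, l)`. -/
def ampLeft {α α' : Type*} (Φ : Op α →ₗ[ℂ] Op α') (β : Type*) :
    Op (α × β) →ₗ[ℂ] Op (α' × β) where
  toFun X := Matrix.of fun p q => Φ (Matrix.of fun i k => X (i, p.2) (k, q.2)) p.1 q.1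
  map_add' X Y := by
    ext p q
    exact congrFun (congrFun (map_add Φ (Matrix.of fun i k => X (i, p.2) (k, q.2))
      (Matrix.of fun i k => Y (i, p.2) (k, q.2))) p.1) q.1
  map_smul' c X := by
    ext p q
    exact congrFun (congrFun (map_smul Φ c (Matrix.of fun i k => X (i, p.2) (k, q.2))) p.1) q.1

/-- `𝟙 ⊗ Ψ`, for a linear map `Ψ` acting on the operators of the second tensor factor. -/
def ampRight {β β' : Type*} (α : Type*) (Ψ : Op β →ₗ[ℂ] Op β') :
    Op (α × β) →ₗ[ℂ] Op (α × β') where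
  toFun X := Matrix.of fun p q => Ψ (Matrix.of fun j l => X (p.1, j) (q.1, l)) p.2 q.2
  map_add' X Y := by
    ext p q
    exact congrFun (congrFun (map_add Ψ (Matrix.of fun j l => X (p.1, j) (q.1, l))
      (Matrix.of fun j l => Y (p.1, j) (q.1, l))) p.2) q.2
  map_smul' c X := by
    ext p q
    exact congrFun (congrFun (map_smul Ψ c (Matrix.of fun j l => X (p.1, j) (q.1, l))) p.2) q.2

/-- Complete positivity: `Φ ⊗ 𝟙_k` maps positive semidefinite operators to positive semidefinite
operators, for every finite dimension `k`. -/
def IsCP {α α' : Type*} (Φ : Op α →ₗ[ℂ] Op α') : Prop :=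
  ∀ (k : ℕ) (X : Op (α × Fin k)), X.PosSemidef → (ampLeft Φ (Fin k) X).PosSemidef

/-- Trace preservation. -/
def IsTP {α α' : Type*} [Fintype α] [Fintype α'] (Φ : Op α →ₗ[ℂ] Op α') : Prop :=
  ∀ X : Op α, (Φ X).trace = X.trace

/-- A quantum channel: a completely positive trace-preserving linear map. -/
def IsChannel {α α' : Type*} [Fintype α] [Fintype α'] (Φ : Op α →ₗ[ℂ] Op α') : Prop :=
  IsCP Φ ∧ IsTP Φ

/-- A quantum state (density operator). -/
def IsState {α : Type*} [Fintype α] (ρ : Op α) : Prop :=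
  ρ.PosSemidef ∧ ρ.trace = 1

/-- The operator `|ψ⟩⟨ψ|`. -/
def ketbra {α : Type*} (ψ : α → ℂ) : Op α :=
  Matrix.vecMulVec ψ (star ψ)

/-- Partial trace over the second tensor factor. -/
def traceB {α β : Type*} [Fintype β] (X : Op (α × β)) : Op α :=
  Matrix.of fun i k => ∑ j, X (i, j) (k, j)

open scoped Classical in
/-- The von Neumann entropy `S(ρ) = -Tr (ρ log₂ ρ) = -∑ λ log₂ λ`, the sum running over the
eigenvalues `λ` of `ρ` with multiplicity and `0 log₂ 0 = 0`
(`Real.negMulLog x = -x * Real.log x`). It is only ever applied to Hermitian operators. -/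
def vonNeumannEntropy {α : Type*} [Fintype α] (ρ : Op α) : ℝ :=
  if h : ρ.IsHermitian then ∑ i, Real.negMulLog (h.eigenvalues i) / Real.log 2 else 0

/-- A finite ensemble `{p i, ψ i}` of normalized pure states with `∑ i, p i |ψ i⟩⟨ψ i| = ρ`. -/
structure IsEnsemble {α : Type*} [Fintype α] {m : ℕ}
    (p : Fin m → ℝ) (ψ : Fin m → α → ℂ) (ρ : Op α) : Prop where
  nonneg : ∀ i, 0 ≤ p i
  sum_eq_one : ∑ i, p i = 1
  normalized : ∀ i, ∑ x, ‖ψ i x‖ ^ 2 = 1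
  average : ∑ i, (p i : ℂ) • ketbra (ψ i) = ρ

/-- The entanglement of formation of a bipartite state: the least average entanglement entropy
`∑ i, p i S(Tr_B |ψ i⟩⟨ψ i|)` over all pure-state ensembles of `ρ`. For a state `ρ` the set below
is nonempty and bounded below by `0`. -/
def entanglementOfFormation {α β : Type*} [Fintype α] [Fintype β] (ρ : Op (α × β)) : ℝ :=
  sInf {e : ℝ | ∃ (m : ℕ) (p : Fin m → ℝ) (ψ : Fin m → α × β → ℂ), IsEnsemble p ψ ρ ∧
    e = ∑ i, p i * vonNeumannEntropy (traceB (ketbra (ψ i)))}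

/-- LOCC channels from `ℂ^a ⊗ ℂ^b` to `ℂ^a' ⊗ ℂ^b'`: finite compositions of one-way LOCC channels.
In a one-way step one party applies an instrument (completely positive maps indexed by the
outcome `x`, with trace-preserving sum) and sends the outcome `x` to the other party, who applies
a channel that depends on `x`. The local dimensions may change from step to step, so ancillas,
discarding of subsystems and local records of earlier outcomes are included. -/
inductive IsLOCC : ∀ {a b a' b' : ℕ},
    (Op (Fin a × Fin b) →ₗ[ℂ] Op (Fin a' × Fin b')) → Prop
  | aliceToBob {a b a' b' r : ℕ} (Φ : Fin r → (Op (Fin a) →ₗ[ℂ] Op (Fin a')))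
      (Ψ : Fin r → (Op (Fin b) →ₗ[ℂ] Op (Fin b')))
      (hCP : ∀ x, IsCP (Φ x)) (hTP : IsTP (∑ x, Φ x)) (hΨ : ∀ x, IsChannel (Ψ x)) :
      IsLOCC (∑ x, (ampLeft (Φ x) (Fin b')).comp (ampRight (Fin a) (Ψ x)))
  | bobToAlice {a b a' b' r : ℕ} (Φ : Fin r → (Op (Fin a) →ₗ[ℂ] Op (Fin a')))
      (Ψ : Fin r → (Op (Fin b) →ₗ[ℂ] Op (Fin b')))
      (hΦ : ∀ x, IsChannel (Φ x)) (hCP : ∀ x, IsCP (Ψ x)) (hTP : IsTP (∑ x, Ψ x)) :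
      IsLOCC (∑ x, (ampLeft (Φ x) (Fin b')).comp (ampRight (Fin a) (Ψ x)))
  | comp {a b a' b' a'' b'' : ℕ} {G : Op (Fin a' × Fin b') →ₗ[ℂ] Op (Fin a'' × Fin b'')}
      {F : Op (Fin a × Fin b) →ₗ[ℂ] Op (Fin a' × Fin b')} :
      IsLOCC G → IsLOCC F → IsLOCC (G.comp F)

/-- The state `Λ_n[ρ] = (Λ ⊗ 𝟙) ∘ F_n ∘ ⋯ ∘ (Λ ⊗ 𝟙) ∘ F_1 [ρ]`, where `F i` stands for the
filter `F_{i+1}`. The dimension of Bob's system before and after the `i`-th filter is `B i` and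
`B (i + 1)`; the usual case of one fixed system `B` is that of a constant family. -/
def repeated {d : ℕ} (Λ : Op (Fin d) →ₗ[ℂ] Op (Fin d)) (B : ℕ → ℕ)
    (F : ∀ i, Op (Fin d × Fin (B i)) →ₗ[ℂ] Op (Fin d × Fin (B (i + 1))))
    (ρ : Op (Fin d × Fin (B 0))) : ∀ n, Op (Fin d × Fin (B n))
  | 0 => ρ
  | n + 1 => ampLeft Λ (Fin (B (n + 1))) (F n (repeated Λ B F ρ n))

/-- For Bob's systems `B`, some initial state and some LOCC filters keep the entanglement of
formation of `Λ_n[ρ]` from vanishing: it has a strictly positive limit as `n → ∞`. -/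
def SustainsEntanglement {d : ℕ} (Λ : Op (Fin d) →ₗ[ℂ] Op (Fin d)) (B : ℕ → ℕ) : Prop :=
  ∃ (ρ : Op (Fin d × Fin (B 0)))
    (F : ∀ i, Op (Fin d × Fin (B i)) →ₗ[ℂ] Op (Fin d × Fin (B (i + 1)))),
    IsState ρ ∧ (∀ i, IsLOCC (F i)) ∧
      ∃ c : ℝ, 0 < c ∧
        Tendsto (fun n => entanglementOfFormation (repeated Λ B F ρ n)) atTop (𝓝 c)

/-- `Λ` has a correctable subspace: a subspace of dimension at least `2` on which some recovery
channel `R` satisfies `R ∘ Λ [|ψ⟩⟨ψ|] = |ψ⟩⟨ψ|`. -/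
def HasCorrectableSubspace {α : Type*} [Fintype α] (Λ : Op α →ₗ[ℂ] Op α) : Prop :=
  ∃ H : Submodule ℂ (α → ℂ), 2 ≤ Module.finrank ℂ H ∧
    ∃ R : Op α →ₗ[ℂ] Op α, IsChannel R ∧ ∀ ψ ∈ H, R (Λ (ketbra ψ)) = ketbra ψ

end QInfo

end

/-! A vector of the bipartite system is written as a matrix `M`, with `M * Mᴴ` as Alice's reduced
state. The tractable entanglement measure is the average linear entropy over a pure-state
decomposition (`HasDecomp`). It does not grow under LOCC (`IsLOCC.hasDecomp`) and is small exactly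
when the entanglement of formation is, with bounds that do not involve Bob's dimension.

If a correctable subspace exists, a maximally entangled state on a two-dimensional part of it is
restored by `R` after each use of `Λ`, so the sequence is constant from the first use on.

Conversely, a measurement by Alice preserves the average linear entropy only if every outcome leaves
Bob's reduced state unchanged up to a factor (`sum_linEnt_mul_add_le`). For Kraus operators that
combine all pairs `K a`, `K b` with four phases (`mixedKraus`), polarization turns this into the
Knill–Laflamme conditions on the range of `M`, hence into a correctable subspace once `M` is not a
product. Without such a subspace the loss is therefore positive at each entangled state. Compactness
makes it uniform (`exists_sum_linEnt_mixedKraus_le`), so every use of `Λ` removes a fixed fraction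
of the excess over `ε`, whatever the filters, and the entanglement of formation eventually stays
below half of its supposed limit. -/

noncomputable section

namespace QInfo

/-! ### Linear entropy under local measurements. -/

/-- The squared Frobenius norm of a matrix. -/
def frobSq {α β : Type*} [Fintype α] [Fintype β] (M : Matrix α β ℂ) : ℝ :=
  ∑ i, ∑ j, ‖M i j‖ ^ 2

/-- The linear entropy of the reduced state of the vector with coefficient matrix `M`,
extended homogeneously to vectors that need not be normalized. -/
def linEnt {α β : Type*} [Fintype α] [Fintype β] (M : Matrix α β ℂ) : ℝ :=
  frobSq M - frobSq (M * M.conjTranspose) / frobSq M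

open Matrix

section Frobenius

variable {α β γ κ : Type*} [Fintype α] [Fintype β] [Fintype γ] [Fintype κ]

lemma coe_frobSq (M : Matrix α β ℂ) : ((frobSq M : ℝ) : ℂ) = (M * Mᴴ).trace := by
  simp [frobSq, Matrix.trace, Matrix.mul_apply, Complex.mul_conj, Complex.normSq_eq_norm_sq]

lemma frobSq_eq_re_trace (M : Matrix α β ℂ) : frobSq M = (M * Mᴴ).trace.re := by
  rw [← coe_frobSq, Complex.ofReal_re]

lemma frobSq_nonneg (M : Matrix α β ℂ) : 0 ≤ frobSq M := by
  unfold frobSq; positivity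

@[simp] lemma frobSq_zero : frobSq (0 : Matrix α β ℂ) = 0 := by simp [frobSq]

lemma frobSq_eq_zero {M : Matrix α β ℂ} : frobSq M = 0 ↔ M = 0 := by
  constructor
  · intro h
    ext i j
    unfold frobSq at h
    rw [Finset.sum_eq_zero_iff_of_nonneg (fun i _ => by positivity)] at h
    have h2 := h i (Finset.mem_univ i)
    rw [Finset.sum_eq_zero_iff_of_nonneg (fun i _ => by positivity)] at h2
    simpa using h2 j (Finset.mem_univ j)
  · rintro rfl; simp

lemma frobSq_smul (c : ℂ) (M : Matrix α β ℂ) : frobSq (c • M) = ‖c‖ ^ 2 * frobSq M := by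
  simp [frobSq, mul_pow, Finset.mul_sum]

lemma frobSq_conjTranspose (M : Matrix α β ℂ) : frobSq Mᴴ = frobSq M := by
  unfold frobSq
  rw [Finset.sum_comm]
  simp

lemma frobSq_gram (M : Matrix α β ℂ) : frobSq (Mᴴ * M) = frobSq (M * Mᴴ) := by
  rw [frobSq_eq_re_trace, frobSq_eq_re_trace]
  simp only [conjTranspose_mul, conjTranspose_conjTranspose, Matrix.mul_assoc]
  rw [Matrix.trace_mul_comm]
  simp only [Matrix.mul_assoc]

lemma linEnt_conjTranspose (M : Matrix α β ℂ) : linEnt Mᴴ = linEnt M := by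
  unfold linEnt
  rw [frobSq_conjTranspose, conjTranspose_conjTranspose, frobSq_gram]

/-- Only Alice's reduced state matters, which later allows Bob's system to be replaced by a copy of
Alice's. -/
lemma linEnt_eq_of_gram_eq {M : Matrix α β ℂ} {N : Matrix α γ ℂ} (h : M * Mᴴ = N * Nᴴ) :
    linEnt M = linEnt N := by
  unfold linEnt
  rw [h, frobSq_eq_re_trace M, frobSq_eq_re_trace N, h]

@[simp] lemma linEnt_zero : linEnt (0 : Matrix α β ℂ) = 0 := by simp [linEnt]

lemma linEnt_smul (c : ℂ) (M : Matrix α β ℂ) : linEnt (c • M) = ‖c‖ ^ 2 * linEnt M := by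
  by_cases hc : c = 0
  · simp [hc]
  have hc' : ‖c‖ ≠ 0 := by simpa using hc
  have : (c • M) * (c • M)ᴴ = (c * star c) • (M * Mᴴ) := by
    simp [conjTranspose_smul, smul_smul, mul_comm]
  unfold linEnt
  rw [this, frobSq_smul, frobSq_smul]
  by_cases hM : frobSq M = 0
  · simp [hM]
  · simp only [norm_mul, norm_star]
    field_simp

/-- A weighted Cauchy–Schwarz inequality with an explicit remainder. -/
lemma sq_norm_div_add_le (z : κ → ℂ) (p : κ → ℝ) (hp : ∀ k, 0 ≤ p k) (hsum : ∑ k, p k = 1)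
    (hz : ∀ k, p k = 0 → z k = 0) :
    ‖∑ k, z k‖ ^ 2 + ∑ k, ‖z k - p k • ∑ k, z k‖ ^ 2 ≤ ∑ k, ‖z k‖ ^ 2 / p k := by
  set s := ∑ k, z k with hs
  -- Completing the square: for `p k > 0` the right side exceeds the first two terms by `‖z k - p k
  -- • s‖ ^ 2 / p k`, and `p k ≤ 1`. Summed over `k`, those two terms give `‖s‖ ^ 2`.
  have key : ∀ k, 2 * inner ℝ (z k) s - p k * ‖s‖ ^ 2 + ‖z k - p k • s‖ ^ 2 ≤ ‖z k‖ ^ 2 / p k := by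
    intro k
    rcases (hp k).eq_or_lt with h0 | h0
    · simp [← h0, hz k h0.symm]
    · have h1 : p k ≤ 1 := by
        rw [← hsum]; exact Finset.single_le_sum (fun i _ => hp i) (Finset.mem_univ k)
      have h2 : ‖z k - p k • s‖ ^ 2 ≤ ‖z k - p k • s‖ ^ 2 / p k := by
        rw [le_div_iff₀ h0]
        exact mul_le_of_le_one_right (by positivity) h1
      have h3 : ‖z k - p k • s‖ ^ 2 =
          ‖z k‖ ^ 2 - 2 * (p k * inner ℝ (z k) s) + p k ^ 2 * ‖s‖ ^ 2 := by
        rw [norm_sub_sq_real, inner_smul_right, norm_smul, mul_pow, Real.norm_eq_abs, sq_abs]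
      have h4 : ‖z k - p k • s‖ ^ 2 / p k =
          ‖z k‖ ^ 2 / p k - 2 * inner ℝ (z k) s + p k * ‖s‖ ^ 2 := by
        rw [h3]; field_simp
      linarith
  have h := Finset.sum_le_sum (fun k (_ : k ∈ Finset.univ) => key k)
  rw [Finset.sum_add_distrib, Finset.sum_sub_distrib, ← Finset.mul_sum, ← sum_inner, ← hs,
    ← Finset.sum_mul, hsum, real_inner_self_eq_norm_sq] at h
  linarith

lemma frobSq_mul_eq_trace (A : Matrix γ α ℂ) (M : Matrix α β ℂ) :
    ((frobSq (A * M) : ℝ) : ℂ) = (Mᴴ * (Aᴴ * A) * M).trace := by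
  rw [coe_frobSq, Matrix.trace_mul_comm]
  simp [conjTranspose_mul, Matrix.mul_assoc]

lemma sum_frobSq_mul [DecidableEq α] {A : κ → Matrix γ α ℂ} (hA : ∑ k, (A k)ᴴ * A k = 1)
    (M : Matrix α β ℂ) : ∑ k, frobSq (A k * M) = frobSq M := by
  apply Complex.ofReal_injective
  rw [Complex.ofReal_sum]
  simp only [frobSq_mul_eq_trace]
  rw [← Matrix.trace_sum, ← Matrix.sum_mul, ← Matrix.mul_sum, hA, Matrix.mul_one, coe_frobSq,
    Matrix.trace_mul_comm]

/-- Under a complete measurement the average linear entropy decreases at least by the squared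
distances between the post-measurement Gram matrices and the multiples of the original one. -/
lemma sum_linEnt_mul_add_le [DecidableEq α] {A : κ → Matrix γ α ℂ}
    (hA : ∑ k, (A k)ᴴ * A k = 1) {M : Matrix α β ℂ} (hM : frobSq M = 1) :
    ∑ k, linEnt (A k * M) +
      ∑ k, frobSq (Mᴴ * ((A k)ᴴ * A k) * M - (frobSq (A k * M) : ℂ) • (Mᴴ * M)) ≤ linEnt M := by
  have hQ : ∀ k, (A k * M)ᴴ * (A k * M) = Mᴴ * ((A k)ᴴ * A k) * M := fun k => by
    simp [conjTranspose_mul, Matrix.mul_assoc]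
  have hQs : ∑ k, Mᴴ * ((A k)ᴴ * A k) * M = Mᴴ * M := by
    rw [← Matrix.sum_mul, ← Matrix.mul_sum, hA, Matrix.mul_one]
  have hsum := sum_frobSq_mul hA M
  rw [hM] at hsum
  unfold linEnt
  -- The purities are computed on Bob's side, where Alice's measurement leaves the average state
  -- unchanged (`hQs`). The inequality above then applies entry by entry, with the outcome
  -- probabilities as weights.
  simp only [← frobSq_gram, hM, hQ, Finset.sum_sub_distrib, hsum]
  suffices frobSq (Mᴴ * M) +
      ∑ k, frobSq (Mᴴ * ((A k)ᴴ * A k) * M - (frobSq (A k * M) : ℂ) • (Mᴴ * M)) ≤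
      ∑ k, frobSq (Mᴴ * ((A k)ᴴ * A k) * M) / frobSq (A k * M) by linarith
  have key : ∀ i j, ‖(Mᴴ * M) i j‖ ^ 2 + ∑ k, ‖(Mᴴ * ((A k)ᴴ * A k) * M -
      (frobSq (A k * M) : ℂ) • (Mᴴ * M)) i j‖ ^ 2 ≤
      ∑ k, ‖(Mᴴ * ((A k)ᴴ * A k) * M) i j‖ ^ 2 / frobSq (A k * M) := by
    intro i j
    have := sq_norm_div_add_le (fun k => (Mᴴ * ((A k)ᴴ * A k) * M) i j)
      (fun k => frobSq (A k * M)) (fun k => frobSq_nonneg _) hsum (fun k hk => by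
        rw [← hQ k, frobSq_eq_zero.mp hk]; simp)
    rw [← Matrix.sum_apply, hQs] at this
    simpa using this
  have h := Finset.sum_le_sum (fun i (_ : i ∈ Finset.univ) =>
    Finset.sum_le_sum (fun j (_ : j ∈ Finset.univ) => key i j))
  simp only [Finset.sum_add_distrib] at h
  unfold frobSq at h ⊢
  refine (le_of_eq ?_).trans (h.trans (le_of_eq ?_))
  · congr 1
    rw [Finset.sum_comm]
    refine Finset.sum_congr rfl fun i _ => ?_
    rw [Finset.sum_comm]
  · simp only [Finset.sum_div]
    conv_rhs => rw [Finset.sum_comm]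
    refine Finset.sum_congr rfl fun i _ => ?_
    rw [Finset.sum_comm]

lemma exists_smul_frobSq_eq_one {M : Matrix α β ℂ} (hM : M ≠ 0) :
    ∃ (c : ℂ) (N : Matrix α β ℂ), M = c • N ∧ frobSq N = 1 ∧ ‖c‖ ^ 2 = frobSq M := by
  have h0 : 0 < frobSq M := (frobSq_nonneg M).lt_of_ne fun h => hM (frobSq_eq_zero.mp h.symm)
  have hs : (0 : ℝ) < √(frobSq M) := Real.sqrt_pos.mpr h0
  have hs' : ((√(frobSq M) : ℝ) : ℂ) ≠ 0 := by exact_mod_cast hs.ne'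
  have hn : ‖((√(frobSq M) : ℝ) : ℂ)‖ ^ 2 = frobSq M := by
    rw [Complex.norm_real, Real.norm_eq_abs, sq_abs, Real.sq_sqrt h0.le]
  refine ⟨(√(frobSq M) : ℝ), ((√(frobSq M) : ℝ) : ℂ)⁻¹ • M, ?_, ?_, hn⟩
  · rw [smul_smul, mul_inv_cancel₀ hs', one_smul]
  · rw [frobSq_smul, norm_inv, inv_pow, hn, inv_mul_cancel₀ h0.ne']

lemma sum_linEnt_mul_le [DecidableEq α] {A : κ → Matrix γ α ℂ}
    (hA : ∑ k, (A k)ᴴ * A k = 1) (M : Matrix α β ℂ) :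
    ∑ k, linEnt (A k * M) ≤ linEnt M := by
  by_cases hM : M = 0
  · simp [hM]
  obtain ⟨c, N, rfl, hN, -⟩ := exists_smul_frobSq_eq_one hM
  simp only [Matrix.mul_smul, linEnt_smul, ← Finset.mul_sum]
  have := sum_linEnt_mul_add_le hA hN
  have h2 : 0 ≤ ∑ k, frobSq (Nᴴ * ((A k)ᴴ * A k) * N - (frobSq (A k * N) : ℂ) • (Nᴴ * N)) :=
    Finset.sum_nonneg fun k _ => frobSq_nonneg _
  exact mul_le_mul_of_nonneg_left (by linarith) (by positivity)

/-- Bob's measurement becomes a measurement from the left on `Mᴴ`, with the entrywise conjugates of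
the `B k`. -/
lemma sum_linEnt_mul_transpose_le [DecidableEq β] {B : κ → Matrix γ β ℂ}
    (hB : ∑ k, (B k)ᴴ * B k = 1) (M : Matrix α β ℂ) :
    ∑ k, linEnt (M * (B k)ᵀ) ≤ linEnt M := by
  have hB' : ∑ k, ((B k).map star)ᴴ * (B k).map star = 1 := by
    rw [← Matrix.transpose_one, ← hB, Matrix.transpose_sum]
    refine Finset.sum_congr rfl fun k _ => ?_
    ext i j
    simp [Matrix.mul_apply, mul_comm]
  have h := sum_linEnt_mul_le hB' Mᴴ
  rw [linEnt_conjTranspose] at h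
  refine (le_of_eq (Finset.sum_congr rfl fun k _ => ?_)).trans h
  rw [← linEnt_conjTranspose, conjTranspose_mul]
  rfl

lemma frobSq_mul_le (A : Matrix γ α ℂ) (M : Matrix α β ℂ) :
    frobSq (A * M) ≤ frobSq A * frobSq M := by
  have key : ∀ i j, ‖(A * M) i j‖ ^ 2 ≤ (∑ k, ‖A i k‖ ^ 2) * ∑ k, ‖M k j‖ ^ 2 := by
    intro i j
    refine le_trans ?_ (Finset.sum_mul_sq_le_sq_mul_sq Finset.univ _ _)
    rw [Matrix.mul_apply]
    gcongr
    refine (norm_sum_le _ _).trans (le_of_eq ?_)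
    simp
  unfold frobSq
  rw [Finset.sum_comm (f := fun i j => ‖M i j‖ ^ 2), Finset.sum_mul_sum]
  exact Finset.sum_le_sum fun i _ => Finset.sum_le_sum fun j _ => key i j

lemma linEnt_nonneg (M : Matrix α β ℂ) : 0 ≤ linEnt M := by
  unfold linEnt
  rw [sub_nonneg]
  apply div_le_of_le_mul₀ (frobSq_nonneg M) (frobSq_nonneg M)
  refine (frobSq_mul_le _ _).trans (le_of_eq ?_)
  rw [frobSq_conjTranspose]

lemma linEnt_vecMulVec (u : α → ℂ) (v : β → ℂ) : linEnt (vecMulVec u v) = 0 := by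
  have h1 : frobSq (vecMulVec u v) = (∑ i, ‖u i‖ ^ 2) * ∑ j, ‖v j‖ ^ 2 := by
    simp [frobSq, vecMulVec_apply, mul_pow, Finset.sum_mul_sum]
  have h2 : frobSq (vecMulVec u v * (vecMulVec u v)ᴴ) = frobSq (vecMulVec u v) ^ 2 := by
    have : vecMulVec u v * (vecMulVec u v)ᴴ =
        ((∑ j, ‖v j‖ ^ 2 : ℝ) : ℂ) • vecMulVec u (star u) := by
      ext i k
      simp only [Matrix.mul_apply, vecMulVec_apply, conjTranspose_apply, Matrix.smul_apply,
        smul_eq_mul, star_mul', Complex.ofReal_sum, Finset.sum_mul, Pi.star_apply]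
      refine Finset.sum_congr rfl fun j _ => ?_
      have := Complex.mul_conj' (v j)
      push_cast
      rw [← this]
      simp only [RCLike.star_def]
      ring
    rw [this, frobSq_smul, h1, Complex.norm_real, Real.norm_eq_abs, sq_abs]
    simp only [frobSq, vecMulVec_apply, Pi.star_apply, norm_mul, norm_star, mul_pow,
      ← Finset.sum_mul_sum]
    ring
  unfold linEnt
  rw [h2]
  by_cases h : frobSq (vecMulVec u v) = 0
  · simp [h]
  · field_simp
    ring

end Frobenius

/-! ### Kraus representations. -/

/-- The vector with coefficient matrix `M`. -/
def toVec {α β : Type*} (M : Matrix α β ℂ) : α × β → ℂ := fun p => M p.1 p.2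

section Kraus

lemma ketbra_toVec_apply {α β : Type*} (M : Matrix α β ℂ) (p q : α × β) :
    ketbra (toVec M) p q = M p.1 p.2 * star (M q.1 q.2) := rfl

lemma ampLeft_apply {α β γ : Type*} (Φ : Op α →ₗ[ℂ] Op γ) (X : Op (α × β)) (p q : γ × β) :
    ampLeft Φ β X p q = Φ (Matrix.of fun i k => X (i, p.2) (k, q.2)) p.1 q.1 := rfl

lemma ampRight_apply {α β γ : Type*} (Φ : Op β →ₗ[ℂ] Op γ) (X : Op (α × β)) (p q : α × γ) :
    ampRight α Φ X p q = Φ (Matrix.of fun j l => X (p.1, j) (q.1, l)) p.2 q.2 := rfl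

lemma posSemidef_ketbra {α : Type*} [Finite α] (ψ : α → ℂ) : (ketbra ψ).PosSemidef :=
  Matrix.posSemidef_vecMulVec_self_star ψ

variable {α β γ κ : Type*} [Fintype α] [Fintype β] [Fintype κ]

/-- The linear map with the given Kraus operators. -/
def krausMap (A : κ → Matrix γ α ℂ) : Op α →ₗ[ℂ] Op γ where
  toFun X := ∑ k, A k * X * (A k)ᴴ
  map_add' X Y := by simp [Matrix.mul_add, Matrix.add_mul, Finset.sum_add_distrib]
  map_smul' c X := by simp [Finset.smul_sum]

lemma krausMap_apply (A : κ → Matrix γ α ℂ) (X : Op α) :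
    krausMap A X = ∑ k, A k * X * (A k)ᴴ := rfl

lemma mul_mul_conjTranspose_apply (A : Matrix γ α ℂ) (X : Op α) (p q : γ) :
    (A * X * Aᴴ) p q = ∑ i, ∑ j, A p i * X i j * star (A q j) := by
  simp only [Matrix.mul_apply, Finset.sum_mul, conjTranspose_apply]
  rw [Finset.sum_comm]

/-- Choi's theorem. -/
lemma IsCP.exists_krausMap [Fintype γ] {a : ℕ} {Φ : Op (Fin a) →ₗ[ℂ] Op γ} (h : IsCP Φ) :
    ∃ (m : ℕ) (A : Fin m → Matrix γ (Fin a) ℂ), Φ = krausMap A := by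
  classical
  -- `toVec 1` is the unnormalized maximally entangled vector, so this decomposes the Choi matrix.
  -- Its vectors, reshaped, are the Kraus operators.
  obtain ⟨m, v, hv⟩ := Matrix.posSemidef_iff_eq_sum_vecMulVec.mp
    (h a _ (posSemidef_ketbra (toVec (1 : Matrix (Fin a) (Fin a) ℂ))))
  refine ⟨m, fun k => Matrix.of fun p j => v k (p, j), ?_⟩
  refine Matrix.ext_linearMap _ fun j l => ?_
  ext p q
  have h1 := congrFun (congrFun hv (p, j)) (q, l)
  rw [ampLeft_apply] at h1
  have h2 : (Matrix.of fun i k => ketbra (toVec (1 : Matrix (Fin a) (Fin a) ℂ)) (i, j) (k, l)) =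
      Matrix.single j l 1 := by
    ext i k
    simp only [Matrix.of_apply, ketbra_toVec_apply, Matrix.single_apply, Matrix.one_apply]
    grind [star_one, star_zero]
  simp only [h2] at h1
  simp [krausMap_apply, Matrix.sum_apply, mul_mul_conjTranspose_apply, h1, Matrix.single_apply,
    vecMulVec_apply, ite_and]

lemma krausMap_ketbra_toVec_left {β : Type*} (A : κ → Matrix γ α ℂ) (M : Matrix α β ℂ) :
    ampLeft (krausMap A) β (ketbra (toVec M)) = ∑ k, ketbra (toVec (A k * M)) := by
  ext p q
  simp only [ampLeft_apply, krausMap_apply, Matrix.sum_apply,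
    ketbra_toVec_apply, Matrix.mul_apply, star_sum, Finset.sum_mul_sum, Matrix.of_apply]
  refine Finset.sum_congr rfl fun k _ => ?_
  rw [Finset.sum_comm]
  simp only [Finset.sum_mul]
  refine Finset.sum_congr rfl fun i _ => Finset.sum_congr rfl fun j _ => ?_
  simp only [star_mul', conjTranspose_apply]
  ring

lemma krausMap_ketbra_toVec_right {α : Type*} (B : κ → Matrix γ β ℂ) (M : Matrix α β ℂ) :
    ampRight α (krausMap B) (ketbra (toVec M)) = ∑ k, ketbra (toVec (M * (B k)ᵀ)) := by
  ext p q
  simp only [ampRight_apply, krausMap_apply, Matrix.sum_apply,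
    ketbra_toVec_apply, Matrix.mul_apply, star_sum, Finset.sum_mul_sum, Matrix.of_apply,
    transpose_apply]
  refine Finset.sum_congr rfl fun k _ => ?_
  rw [Finset.sum_comm]
  simp only [Finset.sum_mul]
  refine Finset.sum_congr rfl fun i _ => Finset.sum_congr rfl fun j _ => ?_
  simp only [star_mul', conjTranspose_apply]
  ring

lemma posSemidef_exists_ketbra {X : Op (α × β)} (hX : X.PosSemidef) :
    ∃ (m : ℕ) (M : Fin m → Matrix α β ℂ), ∑ k, ketbra (toVec (M k)) = X := by
  obtain ⟨m, v, hv⟩ := Matrix.posSemidef_iff_eq_sum_vecMulVec.mp hX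
  exact ⟨m, fun k => Matrix.of fun i j => v k (i, j), hv.symm⟩

lemma isCP_krausMap [Finite γ] (A : κ → Matrix γ α ℂ) : IsCP (krausMap A) := by
  intro k X hX
  obtain ⟨m, M, rfl⟩ := posSemidef_exists_ketbra hX
  simp only [map_sum, krausMap_ketbra_toVec_left]
  exact Matrix.posSemidef_sum _ fun i _ => Matrix.posSemidef_sum _ fun j _ => posSemidef_ketbra _

lemma trace_krausMap [Fintype γ] (A : κ → Matrix γ α ℂ) (X : Op α) :
    (krausMap A X).trace = ((∑ k, (A k)ᴴ * A k) * X).trace := by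
  rw [krausMap_apply, Matrix.trace_sum, Matrix.sum_mul, Matrix.trace_sum]
  refine Finset.sum_congr rfl fun k _ => ?_
  rw [Matrix.trace_mul_comm, Matrix.mul_assoc]

lemma isTP_krausMap_iff [Fintype γ] [DecidableEq α] {A : κ → Matrix γ α ℂ} :
    IsTP (krausMap A) ↔ ∑ k, (A k)ᴴ * A k = 1 := by
  constructor
  · intro h
    rw [Matrix.ext_iff_trace_mul_right]
    intro X
    rw [← trace_krausMap, h, Matrix.one_mul]
  · intro h X
    rw [trace_krausMap, h, Matrix.one_mul]

end Kraus

/-! ### Pure-state decompositions and LOCC monotonicity. -/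

/-- The operator `ρ` is a sum of (unnormalized) pure states of total linear entropy at most `c`. -/
def HasDecomp {α β : Type*} [Fintype α] [Fintype β] (ρ : Op (α × β)) (c : ℝ) : Prop :=
  ∃ (ι : Type) (_ : Fintype ι) (M : ι → Matrix α β ℂ),
    ∑ i, ketbra (toVec (M i)) = ρ ∧ ∑ i, linEnt (M i) ≤ c

section Decomposition

variable {α β : Type*} [Fintype α] [Fintype β]

lemma hasDecomp_ketbra (M : Matrix α β ℂ) : HasDecomp (ketbra (toVec M)) (linEnt M) :=
  ⟨Unit, inferInstance, fun _ => M, by simp, by simp⟩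

lemma HasDecomp.mono {ρ : Op (α × β)} {c c' : ℝ} (h : HasDecomp ρ c) (hc : c ≤ c') :
    HasDecomp ρ c' := by
  obtain ⟨ι, _, M, h1, h2⟩ := h
  exact ⟨ι, _, M, h1, h2.trans hc⟩

lemma HasDecomp.sum {κ : Type} [Fintype κ] {ρ : κ → Op (α × β)} {c : κ → ℝ}
    (h : ∀ k, HasDecomp (ρ k) (c k)) : HasDecomp (∑ k, ρ k) (∑ k, c k) := by
  choose ι _ M h1 h2 using h
  refine ⟨Σ k, ι k, inferInstance, fun x => M x.1 x.2, ?_, ?_⟩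
  · rw [Fintype.sum_sigma]
    exact Finset.sum_congr rfl fun k _ => h1 k
  · rw [Fintype.sum_sigma]
    exact Finset.sum_le_sum fun k _ => h2 k

lemma HasDecomp.nonneg {ρ : Op (α × β)} {c : ℝ} (h : HasDecomp ρ c) : 0 ≤ c := by
  obtain ⟨ι, _, M, -, h2⟩ := h
  exact (Finset.sum_nonneg fun i _ => linEnt_nonneg _).trans h2

lemma HasDecomp.map {α' β' : Type*} [Fintype α'] [Fintype β'] {ρ : Op (α × β)} {c : ℝ}
    (F : Op (α × β) →ₗ[ℂ] Op (α' × β'))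
    (hF : ∀ M, HasDecomp (F (ketbra (toVec M))) (linEnt M)) (h : HasDecomp ρ c) :
    HasDecomp (F ρ) c := by
  obtain ⟨ι, _, M, rfl, h2⟩ := h
  rw [map_sum]
  exact (HasDecomp.sum fun i => hF (M i)).mono h2

end Decomposition

lemma ampLeft_ampRight_krausMap {α β α' β' κ κ' : Type*} [Fintype α] [Fintype β] [Fintype κ]
    [Fintype κ'] (A : κ → Matrix α' α ℂ) (B : κ' → Matrix β' β ℂ) (M : Matrix α β ℂ) :
    ampLeft (krausMap A) β' (ampRight α (krausMap B) (ketbra (toVec M))) =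
      ∑ l, ∑ k, ketbra (toVec (A k * M * (B l)ᵀ)) := by
  rw [krausMap_ketbra_toVec_right, map_sum]
  simp only [krausMap_ketbra_toVec_left, Matrix.mul_assoc]

lemma sum_krausMap {α γ ι : Type*} [Fintype α] [Fintype ι] {κ : ι → Type*} [∀ i, Fintype (κ i)]
    (A : ∀ i, κ i → Matrix γ α ℂ) :
    ∑ i, krausMap (A i) = krausMap (fun x : Σ i, κ i => A x.1 x.2) := by
  refine LinearMap.ext fun X => ?_
  simp only [LinearMap.sum_apply, krausMap_apply]
  rw [Fintype.sum_sigma]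

/-- The average linear entropy does not increase under LOCC. -/
lemma IsLOCC.hasDecomp {a b a' b' : ℕ} {F : Op (Fin a × Fin b) →ₗ[ℂ] Op (Fin a' × Fin b')}
    (hF : IsLOCC F) : ∀ {ρ : Op (Fin a × Fin b)} {c : ℝ}, HasDecomp ρ c → HasDecomp (F ρ) c := by
  induction hF with
  | @aliceToBob a b a' b' r Φ Ψ hCP hTP hΨ =>
    intro ρ c h
    refine h.map _ fun M => ?_
    choose m A hA using fun x => (hCP x).exists_krausMap
    choose n B hB using fun x => (hΨ x).1.exists_krausMap
    obtain rfl : Φ = fun x => krausMap (A x) := funext hA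
    obtain rfl : Ψ = fun x => krausMap (B x) := funext hB
    -- Only the sum over outcomes is trace preserving, so the Kraus operators of all outcomes are
    -- collected into one complete measurement.
    rw [sum_krausMap, isTP_krausMap_iff] at hTP
    have hΨ' := fun x => isTP_krausMap_iff.mp (hΨ x).2
    simp only [LinearMap.sum_apply, LinearMap.comp_apply, ampLeft_ampRight_krausMap]
    refine (HasDecomp.sum fun x => HasDecomp.sum fun l => HasDecomp.sum fun k =>
      hasDecomp_ketbra _).mono ?_
    calc ∑ x, ∑ l, ∑ k, linEnt (A x k * M * (B x l)ᵀ)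
        = ∑ x, ∑ k, ∑ l, linEnt (A x k * M * (B x l)ᵀ) :=
          Finset.sum_congr rfl fun x _ => Finset.sum_comm
      _ ≤ ∑ x, ∑ k, linEnt (A x k * M) := Finset.sum_le_sum fun x _ => Finset.sum_le_sum fun k _ =>
          sum_linEnt_mul_transpose_le (hΨ' x) _
      _ = ∑ y : Σ x, Fin (m x), linEnt (A y.1 y.2 * M) := by rw [Fintype.sum_sigma]
      _ ≤ linEnt M := sum_linEnt_mul_le hTP M
  | @bobToAlice a b a' b' r Φ Ψ hΦ hCP hTP =>
    intro ρ c h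
    refine h.map _ fun M => ?_
    choose m A hA using fun x => (hΦ x).1.exists_krausMap
    choose n B hB using fun x => (hCP x).exists_krausMap
    obtain rfl : Φ = fun x => krausMap (A x) := funext hA
    obtain rfl : Ψ = fun x => krausMap (B x) := funext hB
    rw [sum_krausMap, isTP_krausMap_iff] at hTP
    have hΦ' := fun x => isTP_krausMap_iff.mp (hΦ x).2
    simp only [LinearMap.sum_apply, LinearMap.comp_apply, ampLeft_ampRight_krausMap]
    refine (HasDecomp.sum fun x => HasDecomp.sum fun l => HasDecomp.sum fun k =>
      hasDecomp_ketbra _).mono ?_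
    calc ∑ x, ∑ l, ∑ k, linEnt (A x k * M * (B x l)ᵀ)
        ≤ ∑ x, ∑ l, linEnt (M * (B x l)ᵀ) := by
          refine Finset.sum_le_sum fun x _ => Finset.sum_le_sum fun l _ => ?_
          simp only [Matrix.mul_assoc]
          exact sum_linEnt_mul_le (hΦ' x) _
      _ = ∑ y : Σ x, Fin (n x), linEnt (M * (B y.1 y.2)ᵀ) := by rw [Fintype.sum_sigma]
      _ ≤ linEnt M := sum_linEnt_mul_transpose_le hTP M
  | comp _ _ ihG ihF =>
    intro ρ c h
    exact ihG (ihF h)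

/-! ### Von Neumann entropy against linear entropy. -/

section Entropy

variable {α β : Type*} [Fintype α] [Fintype β]

lemma traceB_ketbra_toVec {α : Type*} (M : Matrix α β ℂ) : traceB (ketbra (toVec M)) = M * Mᴴ := by
  ext i k
  simp [traceB, ketbra_toVec_apply, Matrix.mul_apply]

lemma trace_ketbra_toVec (M : Matrix α β ℂ) : (ketbra (toVec M)).trace = frobSq M := by
  rw [coe_frobSq, Matrix.trace, Matrix.trace, Fintype.sum_prod_type]
  simp [ketbra_toVec_apply, Matrix.mul_apply]

lemma frobSq_eq_sum_eigenvalues_sq [DecidableEq α] {P : Matrix α α ℂ} (hP : P.IsHermitian) :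
    frobSq P = ∑ i, hP.eigenvalues i ^ 2 := by
  apply Complex.ofReal_injective
  rw [coe_frobSq, hP.eq]
  conv_lhs => rw [hP.spectral_theorem, ← map_mul, Unitary.conjStarAlgAut_apply,
    Matrix.trace_mul_comm, ← Matrix.mul_assoc]
  simp [Matrix.trace, sq]

open scoped Classical in
/-- The spectrum of the reduced state of a normalized vector. -/
lemma exists_spectrum {M : Matrix α β ℂ} (hM : frobSq M = 1) : ∃ l : α → ℝ,
    (∀ i, 0 ≤ l i) ∧ (∀ i, l i ≤ 1) ∧ linEnt M = ∑ i, l i * (1 - l i) ∧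
    vonNeumannEntropy (traceB (ketbra (toVec M))) = ∑ i, Real.negMulLog (l i) / Real.log 2 := by
  have hP := Matrix.posSemidef_self_mul_conjTranspose M
  have hs : ∑ i, hP.1.eigenvalues i = 1 := by
    apply Complex.ofReal_injective
    have := hP.1.trace_eq_sum_eigenvalues
    rw [← coe_frobSq, hM] at this
    simpa using this.symm
  refine ⟨hP.1.eigenvalues, hP.eigenvalues_nonneg, fun i => ?_, ?_, ?_⟩
  · rw [← hs]
    exact Finset.single_le_sum (fun i _ => hP.eigenvalues_nonneg i) (Finset.mem_univ i)
  · rw [linEnt, frobSq_eq_sum_eigenvalues_sq hP.1, hM, div_one]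
    conv_lhs => rw [← hs]
    rw [← Finset.sum_sub_distrib]
    exact Finset.sum_congr rfl fun i _ => by ring
  · rw [traceB_ketbra_toVec, vonNeumannEntropy, dif_pos hP.1]

/-- Eigenvalue by eigenvalue, this is `log x ≤ x - 1`. -/
lemma linEnt_div_log_two_le {M : Matrix α β ℂ} (hM : frobSq M = 1) :
    linEnt M / Real.log 2 ≤ vonNeumannEntropy (traceB (ketbra (toVec M))) := by
  obtain ⟨l, h0, h1, h2, h3⟩ := exists_spectrum hM
  rw [h2, h3, Finset.sum_div]
  refine Finset.sum_le_sum fun i _ => ?_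
  have hlog : 0 < Real.log 2 := Real.log_pos one_lt_two
  gcongr
  rcases (h0 i).eq_or_lt with h | h
  · simp [← h]
  · rw [Real.negMulLog]
    nlinarith [Real.log_le_sub_one_of_pos h]

/-- The slope of `negMulLog` at `0` is infinite, so a multiple of `x * (1 - x)` alone cannot
suffice. The term `η` covers `x < δ`; beyond, `negMulLog x ≤ 1 - x ≤ δ⁻¹ * (x * (1 - x))`. -/
lemma exists_negMulLog_le {η : ℝ} (hη : 0 < η) :
    ∃ C, 0 ≤ C ∧ ∀ x, 0 ≤ x → x ≤ 1 → Real.negMulLog x ≤ η + C * (x * (1 - x)) := by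
  have hc : ∀ᶠ x in 𝓝 (0 : ℝ), Real.negMulLog x < η := by
    have := Real.continuous_negMulLog.tendsto 0
    rw [Real.negMulLog_zero] at this
    exact this.eventually_lt_const hη
  obtain ⟨δ, hδ, h⟩ := Metric.eventually_nhds_iff.mp hc
  refine ⟨δ⁻¹, by positivity, fun x hx0 hx1 => ?_⟩
  by_cases hx : x < δ
  · have h1 := h (y := x) (by rwa [Real.dist_eq, sub_zero, abs_of_nonneg hx0])
    have : 0 ≤ δ⁻¹ * (x * (1 - x)) :=
      mul_nonneg (by positivity) (mul_nonneg hx0 (by linarith))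
    linarith
  · push Not at hx
    have hx0' : 0 < x := hδ.trans_le hx
    have h1 : Real.negMulLog x ≤ 1 - x := by
      have := Real.one_sub_inv_le_log_of_pos hx0'
      have h2 := mul_le_mul_of_nonneg_left this hx0
      rw [mul_sub, mul_inv_cancel₀ hx0'.ne'] at h2
      rw [Real.negMulLog]
      linarith
    have h2 : 1 - x ≤ δ⁻¹ * (x * (1 - x)) := by
      rw [← mul_assoc]
      refine le_mul_of_one_le_left (by linarith) ?_
      rw [← div_eq_inv_mul, one_le_div hδ]
      exact hx
    linarith

/-- `C` depends on `η` and Alice's dimension but not on `b`: the sum runs over Alice's eigenvalues,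
among which the error is shared. This is what permits Bob's system to grow. -/
lemma exists_vonNeumannEntropy_le (α : Type*) [Fintype α] {η : ℝ} (hη : 0 < η) :
    ∃ C, 0 ≤ C ∧ ∀ (b : ℕ) (M : Matrix α (Fin b) ℂ), frobSq M = 1 →
      vonNeumannEntropy (traceB (ketbra (toVec M))) ≤ η + C * linEnt M := by
  have hlog : 0 < Real.log 2 := Real.log_pos one_lt_two
  obtain ⟨C, hC, h⟩ := exists_negMulLog_le
    (show 0 < Real.log 2 * η / (Fintype.card α + 1) by positivity)
  refine ⟨C / Real.log 2, by positivity, fun b M hM => ?_⟩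
  obtain ⟨l, h0, h1, h2, h3⟩ := exists_spectrum hM
  rw [h2, h3, ← Finset.sum_div, div_le_iff₀ hlog]
  refine (Finset.sum_le_sum fun i _ => h (l i) (h0 i) (h1 i)).trans ?_
  rw [Finset.sum_add_distrib, ← Finset.mul_sum, add_mul, Finset.sum_const, Finset.card_univ,
    nsmul_eq_mul]
  refine add_le_add ?_ (le_of_eq ?_)
  · rw [mul_div_assoc', div_le_iff₀ (by positivity)]
    nlinarith [mul_pos hlog hη]
  · field_simp

end Entropy

/-! ### Bounds on the entanglement of formation. -/

section Formation

variable {α β : Type*} [Fintype α] [Fintype β]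

lemma frobSq_eq_sum_toVec (M : Matrix α β ℂ) : frobSq M = ∑ x, ‖toVec M x‖ ^ 2 := by
  rw [Fintype.sum_prod_type]; rfl

lemma ketbra_toVec_smul {α β : Type*} (c : ℂ) (M : Matrix α β ℂ) :
    ketbra (toVec (c • M)) = ((‖c‖ ^ 2 : ℝ) : ℂ) • ketbra (toVec M) := by
  ext p q
  have := Complex.mul_conj' c
  simp only [ketbra_toVec_apply, Matrix.smul_apply, smul_eq_mul, star_mul']
  push_cast
  rw [← this]
  simp only [RCLike.star_def]
  ring

/-- A decomposition into pure states can be normalized to an ensemble. -/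
lemma HasDecomp.exists_ensemble {ρ : Op (α × β)} {c : ℝ} (h : HasDecomp ρ c)
    (hρ : ρ.trace = 1) : ∃ (m : ℕ) (p : Fin m → ℝ) (N : Fin m → Matrix α β ℂ),
      IsEnsemble p (fun i => toVec (N i)) ρ ∧ ∑ i, p i * linEnt (N i) ≤ c := by
  obtain ⟨ι, _, M, rfl, h2⟩ := h
  rw [Matrix.trace_sum] at hρ
  simp only [trace_ketbra_toVec] at hρ
  have hρ' : ∑ i, frobSq (M i) = 1 := by exact_mod_cast hρ
  -- Zero vectors cannot be normalized. They receive weight `0` and a spare unit vector `N₀`.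
  obtain ⟨i₀, hi₀⟩ : ∃ i, M i ≠ 0 := by
    by_contra! h
    simp [h] at hρ'
  obtain ⟨-, N₀, -, hN₀, -⟩ := exists_smul_frobSq_eq_one hi₀
  have hN : ∀ i, ∃ (c : ℂ) (N : Matrix α β ℂ), M i = c • N ∧ frobSq N = 1 ∧
      ‖c‖ ^ 2 = frobSq (M i) := by
    intro i
    by_cases hi : M i = 0
    · exact ⟨0, N₀, by simp [hi], hN₀, by simp [hi]⟩
    · exact exists_smul_frobSq_eq_one hi
  choose c N hMN hN1 hcN using hN
  let e := (Fintype.equivFin ι).symm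
  refine ⟨Fintype.card ι, fun i => ‖c (e i)‖ ^ 2, fun i => N (e i),
    ⟨fun i => by positivity, ?_, fun i => ?_, ?_⟩, ?_⟩
  · rw [e.sum_comp (fun i => ‖c i‖ ^ 2)]
    simp only [hcN, hρ']
  · rw [← frobSq_eq_sum_toVec, hN1]
  · rw [e.sum_comp (fun i => ((‖c i‖ ^ 2 : ℝ) : ℂ) • ketbra (toVec (N i)))]
    simp only [← ketbra_toVec_smul, ← hMN]
  · rw [e.sum_comp (fun i => ‖c i‖ ^ 2 * linEnt (N i))]
    simp only [← linEnt_smul, ← hMN, h2]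

lemma toVec_of {α β : Type*} (ψ : α × β → ℂ) : toVec (Matrix.of fun i j => ψ (i, j)) = ψ := rfl

lemma IsEnsemble.frobSq_eq_one {m : ℕ} {p : Fin m → ℝ} {ψ : Fin m → α × β → ℂ}
    {ρ : Op (α × β)} (h : IsEnsemble p ψ ρ) (i : Fin m) :
    frobSq (Matrix.of fun x y => ψ i (x, y)) = 1 := by
  rw [frobSq_eq_sum_toVec, toVec_of, h.normalized]

lemma IsEnsemble.hasDecomp {m : ℕ} {p : Fin m → ℝ} {ψ : Fin m → α × β → ℂ}
    {ρ : Op (α × β)} (h : IsEnsemble p ψ ρ) :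
    HasDecomp ρ (∑ i, p i * linEnt (Matrix.of fun x y => ψ i (x, y))) := by
  have hp : ∀ i, ‖((√(p i) : ℝ) : ℂ)‖ ^ 2 = p i := fun i => by
    rw [Complex.norm_real, Real.norm_eq_abs, sq_abs, Real.sq_sqrt (h.nonneg i)]
  refine ⟨Fin m, inferInstance, fun i => ((√(p i) : ℝ) : ℂ) • Matrix.of fun x y => ψ i (x, y),
    ?_, ?_⟩
  · simp only [ketbra_toVec_smul, hp, toVec_of, h.average]
  · simp only [linEnt_smul, hp, le_refl]

lemma IsEnsemble.sum_linEnt_le {m : ℕ} {p : Fin m → ℝ} {ψ : Fin m → α × β → ℂ}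
    {ρ : Op (α × β)} (h : IsEnsemble p ψ ρ) :
    (∑ i, p i * linEnt (Matrix.of fun x y => ψ i (x, y))) / Real.log 2 ≤
      ∑ i, p i * vonNeumannEntropy (traceB (ketbra (ψ i))) := by
  rw [Finset.sum_div]
  refine Finset.sum_le_sum fun i _ => ?_
  rw [mul_div_assoc]
  exact mul_le_mul_of_nonneg_left (linEnt_div_log_two_le (h.frobSq_eq_one i)) (h.nonneg i)

lemma exists_entanglementOfFormation_le (α : Type*) [Fintype α] {η : ℝ} (hη : 0 < η) :
    ∃ C, 0 ≤ C ∧ ∀ (b : ℕ) (ρ : Op (α × Fin b)) (c : ℝ), ρ.trace = 1 → HasDecomp ρ c →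
      entanglementOfFormation ρ ≤ η + C * c := by
  obtain ⟨C, hC, h⟩ := exists_vonNeumannEntropy_le α hη
  refine ⟨C, hC, fun b ρ c hρ hd => ?_⟩
  obtain ⟨m, p, N, hN, hc⟩ := hd.exists_ensemble hρ
  have hle : entanglementOfFormation ρ ≤
      ∑ i, p i * vonNeumannEntropy (traceB (ketbra (toVec (N i)))) := by
    refine csInf_le ⟨0, ?_⟩ ⟨m, p, _, hN, rfl⟩
    rintro e ⟨m, p, ψ, hψ, rfl⟩
    refine le_trans ?_ hψ.sum_linEnt_le
    have hlog : 0 < Real.log 2 := Real.log_pos one_lt_two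
    exact div_nonneg hψ.hasDecomp.nonneg hlog.le
  refine hle.trans ?_
  calc ∑ i, p i * vonNeumannEntropy (traceB (ketbra (toVec (N i))))
      ≤ ∑ i, p i * (η + C * linEnt (N i)) := Finset.sum_le_sum fun i _ =>
        mul_le_mul_of_nonneg_left (h b _ (hN.frobSq_eq_one i)) (hN.nonneg i)
    _ = η + C * ∑ i, p i * linEnt (N i) := by
        simp only [mul_add, Finset.sum_add_distrib, ← Finset.sum_mul, hN.sum_eq_one, one_mul,
          Finset.mul_sum]
        congr 1
        exact Finset.sum_congr rfl fun i _ => by ring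
    _ ≤ η + C * c := by gcongr

lemma IsState.exists_hasDecomp {ρ : Op (α × β)} (h : IsState ρ) : ∃ c, HasDecomp ρ c := by
  obtain ⟨m, M, hM⟩ := posSemidef_exists_ketbra h.1
  exact ⟨_, Fin m, inferInstance, M, hM, le_rfl⟩

lemma le_entanglementOfFormation {ρ : Op (α × β)} (hρ : IsState ρ) {c₀ : ℝ}
    (h : ∀ c, HasDecomp ρ c → c₀ ≤ c) : c₀ / Real.log 2 ≤ entanglementOfFormation ρ := by
  refine le_csInf ?_ ?_
  · obtain ⟨c, hc⟩ := hρ.exists_hasDecomp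
    obtain ⟨m, p, N, hN, -⟩ := hc.exists_ensemble hρ.2
    exact ⟨_, m, p, _, hN, rfl⟩
  · rintro e ⟨m, p, ψ, hψ, rfl⟩
    refine le_trans ?_ hψ.sum_linEnt_le
    have hlog : 0 < Real.log 2 := Real.log_pos one_lt_two
    gcongr
    exact h _ hψ.hasDecomp

end Formation

/-! ### Trace preservation, and decompositions of a pure state. -/

section LocalChannels

variable {α β α' β' : Type*} [Fintype α] [Fintype β] [Fintype α'] [Fintype β']

lemma trace_traceB (X : Op (α × β)) : (traceB X).trace = X.trace := by
  simp [Matrix.trace, traceB, Fintype.sum_prod_type]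

lemma trace_ampLeft {α : Type*} (Φ : Op α →ₗ[ℂ] Op α') (X : Op (α × β)) :
    (ampLeft Φ β X).trace = (Φ (traceB X)).trace := by
  have : traceB X = ∑ j, Matrix.of fun i k => X (i, j) (k, j) := by
    ext i k
    simp [traceB, Matrix.sum_apply]
  rw [this, map_sum, Matrix.trace_sum, Matrix.trace, Fintype.sum_prod_type_right]
  rfl

lemma trace_ampRight {β : Type*} (Ψ : Op β →ₗ[ℂ] Op β') (X : Op (α × β)) :
    (ampRight α Ψ X).trace = (Ψ (∑ i, Matrix.of fun j l => X (i, j) (i, l))).trace := by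
  rw [map_sum, Matrix.trace_sum, Matrix.trace, Fintype.sum_prod_type]
  rfl

lemma isTP_ampLeft {Φ : Op α →ₗ[ℂ] Op α'} (hΦ : IsTP Φ) : IsTP (ampLeft Φ β) := fun X => by
  rw [trace_ampLeft, hΦ, trace_traceB]

lemma traceB_ampRight {α : Type*} {Ψ : Op β →ₗ[ℂ] Op β'} (hΨ : IsTP Ψ) (X : Op (α × β)) :
    traceB (ampRight α Ψ X) = traceB X := by
  ext i k
  exact hΨ (Matrix.of fun j l => X (i, j) (k, l))

lemma IsLOCC.isTP {a b a' b' : ℕ} {F : Op (Fin a × Fin b) →ₗ[ℂ] Op (Fin a' × Fin b')}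
    (hF : IsLOCC F) : IsTP F := by
  induction hF with
  | aliceToBob Φ Ψ hCP hTP hΨ =>
    intro X
    simp only [LinearMap.sum_apply, LinearMap.comp_apply, Matrix.trace_sum, trace_ampLeft,
      traceB_ampRight (hΨ _).2]
    rw [← Matrix.trace_sum, ← LinearMap.sum_apply, hTP, trace_traceB]
  | bobToAlice Φ Ψ hΦ hCP hTP =>
    intro X
    simp only [LinearMap.sum_apply, LinearMap.comp_apply, Matrix.trace_sum,
      isTP_ampLeft (hΦ _).2 _, trace_ampRight]
    rw [← Matrix.trace_sum, ← LinearMap.sum_apply, hTP]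
    exact (trace_ampRight LinearMap.id X).symm
  | comp _ _ ihG ihF => exact fun X => (ihG _).trans (ihF X)

lemma isChannel_id : IsChannel (LinearMap.id : Op α →ₗ[ℂ] Op α) :=
  ⟨fun _ _ hX => hX, fun _ => rfl⟩

lemma isLOCC_ampLeft {a a' b : ℕ} {Φ : Op (Fin a) →ₗ[ℂ] Op (Fin a')} (hΦ : IsChannel Φ) :
    IsLOCC (ampLeft Φ (Fin b)) := by
  have := IsLOCC.aliceToBob (b := b) (fun _ : Fin 1 => Φ) (fun _ => LinearMap.id)
    (fun _ => hΦ.1) (by simpa using hΦ.2) (fun _ => isChannel_id)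
  rw [Fin.sum_univ_one] at this
  exact this

lemma isLOCC_id {a b : ℕ} :
    IsLOCC (LinearMap.id : Op (Fin a × Fin b) →ₗ[ℂ] Op (Fin a × Fin b)) :=
  isLOCC_ampLeft isChannel_id

lemma IsState.ampLeft {a b a' : ℕ} {Φ : Op (Fin a) →ₗ[ℂ] Op (Fin a')} (hΦ : IsChannel Φ)
    {ρ : Op (Fin a × Fin b)} (hρ : IsState ρ) : IsState (ampLeft Φ (Fin b) ρ) :=
  ⟨hΦ.1 b ρ hρ.1, by rw [isTP_ampLeft hΦ.2, hρ.2]⟩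

/-- Every decomposition of a pure state is trivial. -/
lemma HasDecomp.linEnt_le {N : Matrix α β ℂ} (hN : frobSq N = 1) {c : ℝ}
    (h : HasDecomp (ketbra (toVec N)) c) : linEnt N ≤ c := by
  obtain ⟨ι, _, M, hM, hc⟩ := h
  refine le_trans (le_of_eq ?_) hc
  set u := toVec N with hu
  have hentry : ∀ x y, ∑ i, toVec (M i) x * star (toVec (M i) y) = u x * star (u y) := by
    intro x y
    have := congrFun (congrFun hM x) y
    rwa [Matrix.sum_apply] at this
  -- The squared `2 × 2` minors of `toVec (M i)` against `u`, summed over `i`, cancel by `hentry`.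
  -- Hence each `M i` is parallel to `N`.
  have hprop : ∀ i x y, toVec (M i) x * u y = toVec (M i) y * u x := by
    intro i x y
    have hz : ∑ i, ((‖toVec (M i) x * u y - toVec (M i) y * u x‖ ^ 2 : ℝ) : ℂ) = 0 := by
      have : ∀ i, ((‖toVec (M i) x * u y - toVec (M i) y * u x‖ ^ 2 : ℝ) : ℂ) =
          toVec (M i) x * star (toVec (M i) x) * (u y * star (u y))
          - toVec (M i) x * star (toVec (M i) y) * (u y * star (u x))
          - toVec (M i) y * star (toVec (M i) x) * (u x * star (u y))
          + toVec (M i) y * star (toVec (M i) y) * (u x * star (u x)) := by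
        intro i
        push_cast
        rw [← Complex.mul_conj']
        simp only [map_sub, map_mul, RCLike.star_def]
        ring
      simp only [this, Finset.sum_add_distrib, Finset.sum_sub_distrib, ← Finset.sum_mul, hentry]
      ring
    have hz' : ∑ i, ‖toVec (M i) x * u y - toVec (M i) y * u x‖ ^ 2 = 0 := by exact_mod_cast hz
    rw [Finset.sum_eq_zero_iff_of_nonneg (fun i _ => by positivity)] at hz'
    have := hz' i (Finset.mem_univ i)
    rwa [sq_eq_zero_iff, norm_eq_zero, sub_eq_zero] at this
  obtain ⟨y, hy⟩ : ∃ y, u y ≠ 0 := by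
    by_contra! h
    rw [frobSq_eq_sum_toVec] at hN
    simp [← hu, h] at hN
  have hMi : ∀ i, M i = (toVec (M i) y / u y) • N := by
    intro i
    ext a b
    have := hprop i (a, b) y
    change toVec (M i) (a, b) = toVec (M i) y / u y * u (a, b)
    field_simp
    exact this
  have hsum : ∑ i, ‖toVec (M i) y / u y‖ ^ 2 = 1 := by
    have h1 := congrArg Matrix.trace hM
    rw [Matrix.trace_sum] at h1
    simp only [hu, trace_ketbra_toVec, hN] at h1
    have h2 : ∑ i, frobSq (M i) = 1 := by exact_mod_cast h1
    rw [← h2]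
    refine Finset.sum_congr rfl fun i _ => ?_
    conv_rhs => rw [hMi i, frobSq_smul, hN, mul_one]
  calc linEnt N = ∑ i, ‖toVec (M i) y / u y‖ ^ 2 * linEnt N := by
        rw [← Finset.sum_mul, hsum, one_mul]
    _ = ∑ i, linEnt (M i) := Finset.sum_congr rfl fun i _ => by
        conv_rhs => rw [hMi i, linEnt_smul]

end LocalChannels

/-! ### A correctable subspace sustains entanglement. -/

section Correctable

variable {α : Type*} [Fintype α]

/-- Polarization. The off-diagonal operators are needed because the recovery acts on one half of an
entangled state. -/
lemma map_vecMulVec_of_map_ketbra {H : Submodule ℂ (α → ℂ)} {T : Op α →ₗ[ℂ] Op α}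
    (hT : ∀ ψ ∈ H, T (ketbra ψ) = ketbra ψ) {ψ φ : α → ℂ} (hψ : ψ ∈ H) (hφ : φ ∈ H) :
    T (vecMulVec ψ (star φ)) = vecMulVec ψ (star φ) := by
  have key : (2 : ℂ) • vecMulVec ψ (star φ) = (ketbra (ψ + φ) - ketbra ψ - ketbra φ) +
      Complex.I • (ketbra (ψ + Complex.I • φ) - ketbra ψ - ketbra φ) := by
    ext i j
    simp only [ketbra, vecMulVec_apply, Matrix.smul_apply, Matrix.add_apply, Matrix.sub_apply,
      Pi.star_apply, Pi.add_apply, Pi.smul_apply, smul_eq_mul, star_add, star_mul',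
      RCLike.star_def, Complex.conj_I]
    linear_combination (ψ i * (starRingEnd ℂ) (φ j) - φ i * (starRingEnd ℂ) (ψ j)
      + Complex.I * φ i * (starRingEnd ℂ) (φ j)) * Complex.I_sq
  have h2 : (2 : ℂ) • T (vecMulVec ψ (star φ)) = (2 : ℂ) • vecMulVec ψ (star φ) := by
    rw [← map_smul, key]
    simp only [map_add, map_sub, map_smul, hT _ hψ, hT _ hφ, hT _ (H.add_mem hψ hφ),
      hT _ (H.add_mem hψ (H.smul_mem Complex.I hφ))]
  exact smul_right_injective _ two_ne_zero h2

lemma exists_orthonormal_pair {H : Submodule ℂ (α → ℂ)} (hH : 2 ≤ Module.finrank ℂ H) :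
    ∃ M : Matrix α (Fin 2) ℂ, (∀ j, (fun i => M i j) ∈ H) ∧ Mᴴ * M = 1 := by
  let e := (WithLp.linearEquiv 2 ℂ (α → ℂ)).symm
  let H' : Submodule ℂ (EuclideanSpace ℂ α) := H.map e.toLinearMap
  have hfin : Module.finrank ℂ H' = Module.finrank ℂ H := LinearEquiv.finrank_map_eq e H
  let b := stdOrthonormalBasis ℂ H'
  have hle : 2 ≤ Module.finrank ℂ H' := hfin ▸ hH
  refine ⟨Matrix.of fun i j => (b (Fin.castLE hle j) : EuclideanSpace ℂ α) i, fun j => ?_, ?_⟩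
  · obtain ⟨v, hv, hv'⟩ := (b (Fin.castLE hle j)).2
    simp only [Matrix.of_apply, ← hv']
    exact hv
  · ext j k
    have := orthonormal_iff_ite.mp b.orthonormal (Fin.castLE hle j) (Fin.castLE hle k)
    rw [Submodule.coe_inner, EuclideanSpace.inner_eq_star_dotProduct] at this
    simp only [(Fin.castLE_injective hle).eq_iff] at this
    rw [Matrix.one_apply, ← this, Matrix.mul_apply, dotProduct]
    exact Finset.sum_congr rfl fun i _ => mul_comm _ _

lemma ampLeft_comp_ampLeft {α β γ δ : Type*} (Φ : Op γ →ₗ[ℂ] Op δ) (Ψ : Op α →ₗ[ℂ] Op γ)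
    (X : Op (α × β)) : ampLeft Φ β (ampLeft Ψ β X) = ampLeft (Φ.comp Ψ) β X := rfl

lemma linEnt_of_orthonormal_pair {M : Matrix α (Fin 2) ℂ} (hM : Mᴴ * M = 1) :
    frobSq M = 2 ∧ linEnt M = 1 := by
  have h1 : frobSq M = 2 := by
    rw [← frobSq_conjTranspose, frobSq_eq_re_trace, conjTranspose_conjTranspose, hM]
    simp
  have h2 : frobSq (M * Mᴴ) = 2 := by
    rw [← frobSq_gram, hM, frobSq_eq_re_trace]
    simp
  exact ⟨h1, by rw [linEnt, h1, h2]; norm_num⟩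

end Correctable

/-- Positivity of the constant value comes from monotonicity: `R` carries any decomposition of the
damaged state to one of `ρ`, whose linear entropy is `1 / 2`. -/
lemma HasCorrectableSubspace.sustainsEntanglement {d : ℕ} {Λ : Op (Fin d) →ₗ[ℂ] Op (Fin d)}
    (hΛ : IsChannel Λ) (h : HasCorrectableSubspace Λ) : SustainsEntanglement Λ fun _ => 2 := by
  obtain ⟨H, hH, R, hR, hRΛ⟩ := h
  obtain ⟨M, hMH, hM⟩ := exists_orthonormal_pair hH
  obtain ⟨hM2, hM1⟩ := linEnt_of_orthonormal_pair hM
  have hM0 : M ≠ 0 := by rintro rfl; simp at hM2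
  obtain ⟨c, N, hMN, hN, hc⟩ := exists_smul_frobSq_eq_one hM0
  have hc0 : c ≠ 0 := by rintro rfl; simp [hM2] at hc
  have hNent : linEnt N = 1 / 2 := by
    rw [hMN, linEnt_smul, hc, hM2] at hM1
    linarith
  have hNH : ∀ j, (fun i => N i j) ∈ H := by
    intro j
    have : (fun i => N i j) = c⁻¹ • fun i => M i j := by
      ext i
      simp [hMN, hc0]
    rw [this]
    exact H.smul_mem _ (hMH j)
  let ρ : Op (Fin d × Fin 2) := ketbra (toVec N)
  have hρ : IsState ρ := ⟨posSemidef_ketbra _, by rw [trace_ketbra_toVec, hN]; simp⟩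
  have hrec : ampLeft R (Fin 2) (ampLeft Λ (Fin 2) ρ) = ρ := by
    ext p q
    rw [ampLeft_comp_ampLeft, ampLeft_apply]
    exact congrFun (congrFun (map_vecMulVec_of_map_ketbra (T := R.comp Λ) hRΛ (hNH p.2)
      (hNH q.2)) p.1) q.1
  have hσ := hρ.ampLeft hΛ
  -- The first filter is the identity, as `ρ` has not yet passed through `Λ`.
  let F : ℕ → (Op (Fin d × Fin 2) →ₗ[ℂ] Op (Fin d × Fin 2)) :=
    fun n => n.casesOn LinearMap.id fun _ => ampLeft R (Fin 2)
  have hrep : ∀ n, repeated Λ (fun _ => 2) F ρ (n + 1) = ampLeft Λ (Fin 2) ρ := by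
    intro n
    induction n with
    | zero => rfl
    | succ n ih =>
      rw [repeated, ih]
      exact congrArg _ hrec
  refine ⟨ρ, F, hρ, fun n => ?_, entanglementOfFormation (ampLeft Λ (Fin 2) ρ), ?_, ?_⟩
  · cases n with
    | zero => exact isLOCC_id
    | succ n => exact isLOCC_ampLeft hR
  · refine lt_of_lt_of_le ?_ (le_entanglementOfFormation hσ (c₀ := 1 / 2) fun c hc => ?_)
    · have := Real.log_pos one_lt_two
      positivity
    · have := (isLOCC_ampLeft hR).hasDecomp hc
      rw [hrec] at this
      exact hNent ▸ this.linEnt_le hN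
  · rw [← tendsto_add_atTop_iff_nat 1]
    simp only [hrep]
    exact tendsto_const_nhds

/-! ### Knill–Laflamme conditions and recovery. -/

section KnillLaflamme

variable {α β κ : Type*} [Fintype α] [Fintype β] [Fintype κ]

lemma exists_vecMulVec_of_rank_lt_two {α : Type*} {M : Matrix α β ℂ} (h : M.rank < 2) :
    ∃ u v, M = vecMulVec u v := by
  classical
  obtain ⟨⟨u, _⟩, hu⟩ := (finrank_le_one_iff (K := ℂ)
    (V := LinearMap.range M.mulVecLin)).mp (Nat.lt_succ_iff.mp h)
  choose c hc using fun j => hu ⟨M *ᵥ Pi.single j 1, ⟨Pi.single j 1, rfl⟩⟩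
  refine ⟨u, c, ?_⟩
  ext i j
  have := congrFun (congrArg Subtype.val (hc j)) i
  simpa [vecMulVec_apply, mul_comm] using this.symm

/-- The Knill–Laflamme conditions can be diagonalized. -/
lemma exists_diagonal_knillLaflamme [Nonempty β] [DecidableEq α] [DecidableEq β]
    [DecidableEq κ] {K : κ → Matrix α α ℂ}
    (hK : ∑ a, (K a)ᴴ * K a = 1) {V : Matrix α β ℂ} (hV : Vᴴ * V = 1)
    {c : Matrix κ κ ℂ} (hc : ∀ a b, (K a * V)ᴴ * (K b * V) = c a b • (1 : Matrix β β ℂ)) :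
    ∃ (W : κ → Matrix α β ℂ) (l : κ → ℝ), (∀ k, 0 ≤ l k) ∧ ∑ k, l k = 1 ∧
      (∀ k k', (W k)ᴴ * W k' = if k = k' then (l k : ℂ) • (1 : Matrix β β ℂ) else 0) ∧
      ∀ X : Op β, krausMap K (V * X * Vᴴ) = ∑ k, W k * X * (W k)ᴴ := by
  inhabit β
  have hentry : ∀ a b, c a b = ((K a * V)ᴴ * (K b * V)) default default := fun a b => by
    rw [hc, Matrix.smul_apply, Matrix.one_apply_eq, smul_eq_mul, mul_one]
  have hherm : c.IsHermitian := by
    ext a b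
    rw [conjTranspose_apply, hentry, hentry, ← conjTranspose_apply, conjTranspose_mul,
      conjTranspose_conjTranspose]
  -- Mixing Kraus operators by a unitary leaves the channel unchanged; the eigenvectors of `c` make
  -- the error spaces mutually orthogonal.
  let U : Matrix κ κ ℂ := (hherm.eigenvectorUnitary).1
  have hUU : U * Uᴴ = 1 := Unitary.mul_star_self_of_mem hherm.eigenvectorUnitary.2
  have hdiag : Uᴴ * c * U = diagonal (fun k => (hherm.eigenvalues k : ℂ)) := by
    have := hherm.conjStarAlgAut_star_eigenvectorUnitary
    rw [Unitary.conjStarAlgAut_star_apply] at this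
    exact this
  have hW : ∀ k k', (∑ b, U b k • (K b * V))ᴴ * (∑ b, U b k' • (K b * V)) =
      if k = k' then (hherm.eigenvalues k : ℂ) • (1 : Matrix β β ℂ) else 0 := by
    intro k k'
    have h1 : (∑ b, U b k • (K b * V))ᴴ * (∑ b, U b k' • (K b * V)) =
        (Uᴴ * c * U) k k' • (1 : Matrix β β ℂ) := by
      simp only [conjTranspose_sum, conjTranspose_smul, Matrix.sum_mul, Matrix.mul_sum,
        Matrix.smul_mul, Matrix.mul_smul, hc, smul_smul, ← Finset.sum_smul]
      congr 1
      simp only [Matrix.mul_apply, Finset.sum_mul, Finset.mul_sum, conjTranspose_apply]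
      exact Finset.sum_congr rfl fun _ _ => Finset.sum_congr rfl fun _ _ => by ring
    rw [h1, hdiag, diagonal_apply]
    split_ifs <;> simp
  refine ⟨fun k => ∑ b, U b k • (K b * V), hherm.eigenvalues, fun k => ?_, ?_, hW, fun X => ?_⟩
  · have h1 := (Matrix.posSemidef_conjTranspose_mul_self
      (∑ b, U b k • (K b * V))).diag_nonneg (i := default)
    rw [hW, if_pos rfl] at h1
    simpa using h1
  · apply Complex.ofReal_injective
    have h1 := hherm.trace_eq_sum_eigenvalues
    have h2 : ∑ a, (K a * V)ᴴ * (K a * V) = (1 : Matrix β β ℂ) := by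
      have : ∀ a, (K a * V)ᴴ * (K a * V) = Vᴴ * ((K a)ᴴ * K a) * V := fun a => by
        simp [conjTranspose_mul, Matrix.mul_assoc]
      simp only [this]
      rw [← Matrix.sum_mul, ← Matrix.mul_sum, hK, Matrix.mul_one, hV]
    have h3 : c.trace = 1 := by
      simp only [Matrix.trace, Matrix.diag_apply, hentry]
      rw [← Matrix.sum_apply, h2, Matrix.one_apply_eq]
    rw [h3] at h1
    simpa using h1.symm
  · have hUU' : ∀ a b, ∑ k, U a k * star (U b k) = if a = b then 1 else 0 := fun a b => by
      have := congrFun (congrFun hUU a) b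
      rwa [Matrix.mul_apply, Matrix.one_apply] at this
    symm
    calc ∑ k, (∑ b, U b k • (K b * V)) * X * (∑ b, U b k • (K b * V))ᴴ
        = ∑ k, ∑ b, ∑ a, (U a k * star (U b k)) • (K a * V * X * (K b * V)ᴴ) := by
          simp only [conjTranspose_sum, conjTranspose_smul, Matrix.sum_mul, Matrix.mul_sum,
            Matrix.smul_mul, Matrix.mul_smul, Finset.smul_sum, smul_smul, mul_comm]
      _ = ∑ b, ∑ a, (∑ k, U a k * star (U b k)) • (K a * V * X * (K b * V)ᴴ) := by
          rw [Finset.sum_comm]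
          refine Finset.sum_congr rfl fun b _ => ?_
          rw [Finset.sum_comm]
          simp only [Finset.sum_smul]
      _ = krausMap K (V * X * Vᴴ) := by
          simp only [hUU', ite_smul, one_smul, zero_smul, Finset.sum_ite_eq', Finset.mem_univ,
            if_true, krausMap_apply, conjTranspose_mul, Matrix.mul_assoc]

/-- The recovery channel of a code that satisfies the Knill–Laflamme conditions. -/
lemma exists_recovery [Nonempty β] {K : κ → Matrix α α ℂ} [DecidableEq α] [DecidableEq β]
    (hK : ∑ a, (K a)ᴴ * K a = 1) {V : Matrix α β ℂ} (hV : Vᴴ * V = 1)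
    {c : Matrix κ κ ℂ} (hc : ∀ a b, (K a * V)ᴴ * (K b * V) = c a b • (1 : Matrix β β ℂ)) :
    ∃ R : Op α →ₗ[ℂ] Op α, IsChannel R ∧
      ∀ X : Op β, R (krausMap K (V * X * Vᴴ)) = V * X * Vᴴ := by
  classical
  obtain ⟨W, l, hl, hl1, hW, hKW⟩ := exists_diagonal_knillLaflamme hK hV hc
  let r : κ → ℂ := fun k => (√(l k) : ℝ)
  have hr : ∀ k, r k * r k = l k := fun k => by
    simp only [r]; rw [← Complex.ofReal_mul, Real.mul_self_sqrt (hl k)]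
  have hrs : ∀ k, star (r k) = r k := fun k => Complex.conj_ofReal _
  have hrs' : ∀ k, star (r k)⁻¹ = (r k)⁻¹ := fun k => by rw [star_inv₀, hrs]
  -- `T k` is the isometry onto the `k`-th error space. If `l k = 0`, then `W k = 0` and the
  -- convention `0⁻¹ = 0` gives `T k = 0`.
  let T : κ → Matrix α β ℂ := fun k => (r k)⁻¹ • W k
  have hTW : ∀ k k', (T k)ᴴ * W k' = if k = k' then r k • (1 : Matrix β β ℂ) else 0 := by
    intro k k'
    simp only [T, conjTranspose_smul, Matrix.smul_mul, hW, hrs']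
    split_ifs
    · rw [smul_smul, ← hr, ← mul_assoc, inv_mul_mul_self]
    · simp
  have hWT : ∀ k, W k = r k • T k := by
    intro k
    by_cases h : r k = 0
    · have : (W k)ᴴ * W k = 0 := by rw [hW, if_pos rfl, ← hr, h]; simp
      simp [Matrix.conjTranspose_mul_self_eq_zero.mp this, T]
    · simp [T, smul_smul, h]
  let E : Matrix α α ℂ := 1 - ∑ k, T k * (T k)ᴴ
  have hEW : ∀ k, E * W k = 0 := by
    intro k
    have : (1 - ∑ k, T k * (T k)ᴴ) * W k = 0 := by
      rw [Matrix.sub_mul, Matrix.one_mul, Matrix.sum_mul, Finset.sum_eq_single k]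
      · rw [Matrix.mul_assoc, hTW, if_pos rfl, Matrix.mul_smul, Matrix.mul_one, ← hWT, sub_self]
      · intro k' _ hk
        rw [Matrix.mul_assoc, hTW, if_neg hk, Matrix.mul_zero]
      · simp
    exact this
  have hET : ∀ k, E * T k = 0 := fun k => by simp [T, hEW]
  have hEH : Eᴴ = E := by simp [E, conjTranspose_sum]
  have hEE : Eᴴ * E = E := by
    rw [hEH]
    have : E * (1 - ∑ k, T k * (T k)ᴴ) = E := by
      simp [Matrix.mul_sub, Matrix.mul_sum, ← Matrix.mul_assoc, hET]
    exact this

  inhabit β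
  let v : α → ℂ := fun i => V i default
  have hv : star v ⬝ᵥ v = 1 := by
    have := congrFun (congrFun hV default) default
    rwa [Matrix.mul_apply, Matrix.one_apply_eq] at this
  -- Each error space is rotated back to the code. The complement, with projection `E`, is reset to
  -- the code vector `v`, which makes the map trace preserving.
  let A : κ ⊕ α → Matrix α α ℂ := Sum.elim (fun k => V * (T k)ᴴ) fun i => vecMulVec v (E i)
  refine ⟨krausMap A, ⟨isCP_krausMap A, isTP_krausMap_iff.mpr ?_⟩, fun X => ?_⟩
  · rw [Fintype.sum_sum_type]
    have h1 : ∀ k, (A (Sum.inl k))ᴴ * A (Sum.inl k) = T k * (T k)ᴴ := fun k => by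
      simp only [A, Sum.elim_inl, conjTranspose_mul, conjTranspose_conjTranspose]
      rw [Matrix.mul_assoc, ← Matrix.mul_assoc Vᴴ, hV, Matrix.one_mul]
    have h2 : ∑ i, (A (Sum.inr i))ᴴ * A (Sum.inr i) = Eᴴ * E := by
      ext x y
      simp only [A, Sum.elim_inr, Matrix.sum_apply, conjTranspose_vecMulVec,
        vecMulVec_mul_vecMulVec, hv, Matrix.mul_apply, one_smul, vecMulVec_apply,
        conjTranspose_apply, Pi.star_apply]
    simp only [h1, h2, hEE]
    simp [E]
  · rw [hKW, krausMap_apply, Fintype.sum_sum_type]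
    have h1 : ∀ k, A (Sum.inl k) * (∑ k', W k' * X * (W k')ᴴ) * (A (Sum.inl k))ᴴ =
        (l k : ℂ) • (V * X * Vᴴ) := by
      intro k
      have : ∀ k', (W k')ᴴ * T k = if k = k' then r k • (1 : Matrix β β ℂ) else 0 := fun k' => by
        rw [← conjTranspose_conjTranspose (T k), ← conjTranspose_mul, hTW]
        split_ifs
        · rw [conjTranspose_smul, hrs, conjTranspose_one]
        · simp
      calc _ = ∑ k', V * ((T k)ᴴ * W k') * X * ((W k')ᴴ * T k) * Vᴴ := by
            simp [A, Matrix.mul_sum, Matrix.sum_mul, conjTranspose_mul, Matrix.mul_assoc]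
        _ = _ := by
            rw [Finset.sum_eq_single k]
            · simp [hTW, this, smul_smul, hr]
            · intro k' _ hk
              simp [hTW, hk.symm]
            · simp
    have h2 : ∀ i, A (Sum.inr i) * (∑ k', W k' * X * (W k')ᴴ) * (A (Sum.inr i))ᴴ = 0 := by
      intro i
      have h3 : A (Sum.inr i) = vecMulVec v (Pi.single i 1) * E := by
        ext x y
        simp [A, vecMulVec_mul, Matrix.row]
      rw [h3, Matrix.mul_assoc (vecMulVec _ _), Matrix.mul_sum]
      simp only [← Matrix.mul_assoc E, hEW]
      simp
    simp only [h1, h2, Finset.sum_const_zero, add_zero, ← Finset.sum_smul]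
    rw [← Complex.ofReal_sum, hl1]
    simp

/-- The Knill–Laflamme conditions on the range of `M` yield a correctable subspace, unless `M` is
the coefficient matrix of a product vector. -/
lemma hasCorrectableSubspace_of_knillLaflamme [DecidableEq α] {K : κ → Matrix α α ℂ}
    (hK : ∑ a, (K a)ᴴ * K a = 1) {M : Matrix α β ℂ} (hM : linEnt M ≠ 0)
    {c : Matrix κ κ ℂ} (hc : ∀ a b, (K a * M)ᴴ * (K b * M) = c a b • (Mᴴ * M)) :
    HasCorrectableSubspace (krausMap K) := by
  classical
  have hrank : 2 ≤ M.rank := by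
    by_contra! h
    obtain ⟨u, v, rfl⟩ := exists_vecMulVec_of_rank_lt_two h
    exact hM (linEnt_vecMulVec u v)
  obtain ⟨V, hVM, hV⟩ := exists_orthonormal_pair (H := LinearMap.range M.mulVecLin) hrank
  choose x hx using hVM
  obtain rfl : V = M * Matrix.of fun i j => x j i := by
    ext i j
    exact (congrFun (hx j) i).symm
  set Y : Matrix β (Fin 2) ℂ := Matrix.of fun i j => x j i
  -- Since the orthonormal pair is `M * Y`, sandwiching `hc` between `Yᴴ` and `Y` replaces `Mᴴ * M`
  -- by `1`.
  have hc' : ∀ a b, (K a * (M * Y))ᴴ * (K b * (M * Y)) = c a b • (1 : Matrix (Fin 2) (Fin 2) ℂ) := by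
    intro a b
    have := congrArg (fun Z => Yᴴ * Z * Y) (hc a b)
    rw [← hV]
    simpa [conjTranspose_mul, Matrix.mul_assoc] using this
  obtain ⟨R, hR, hRK⟩ := exists_recovery hK hV hc'
  refine ⟨LinearMap.range (M * Y).mulVecLin, ?_, R, hR, ?_⟩
  · rw [LinearMap.finrank_range_of_inj, Module.finrank_fintype_fun_eq_card, Fintype.card_fin]
    intro u w huw
    have := congrArg (fun z => (M * Y)ᴴ *ᵥ z) huw
    simp only [Matrix.mulVecLin_apply, Matrix.mulVec_mulVec, hV, Matrix.one_mulVec] at this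
    exact this
  · rintro _ ⟨w, rfl⟩
    have : ketbra ((M * Y).mulVecLin w) = (M * Y) * ketbra w * (M * Y)ᴴ := by
      rw [ketbra, ketbra, Matrix.mulVecLin_apply, Matrix.mul_vecMulVec, Matrix.vecMulVec_mul,
        Matrix.star_mulVec]
    rw [this, hRK]

end KnillLaflamme

/-! ### Polarized Kraus operators. -/

section Mixing

variable {α γ κ : Type*} [Fintype α] [Fintype κ]

/-- The Kraus operators `(K a + i ^ s K b) / √(8 |κ|)` of the channel with Kraus operators `K`. -/
def mixedKraus (K : κ → Matrix γ α ℂ) (x : κ × κ × Fin 4) : Matrix γ α ℂ :=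
  ((√(8 * Fintype.card κ))⁻¹ : ℝ) • (K x.1 + Complex.I ^ (x.2.2 : ℕ) • K x.2.1)

lemma krausMap_mixedKraus (K : κ → Matrix γ α ℂ) : krausMap (mixedKraus K) = krausMap K := by
  refine LinearMap.ext fun X => ?_
  -- The four phases cancel the cross terms and contribute a factor `4`. Each `K a` then occurs `2
  -- |κ|` times among the pairs, whence the normalization `8 |κ|`.
  have h4 : ∀ a b, ∑ s : Fin 4, mixedKraus K (a, b, s) * X * (mixedKraus K (a, b, s))ᴴ =
      ((2 * Fintype.card κ : ℝ)⁻¹ : ℝ) • (K a * X * (K a)ᴴ + K b * X * (K b)ᴴ) := by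
    intro a b
    have h0 : ∑ s : Fin 4, (K a + Complex.I ^ (s : ℕ) • K b) * X *
        (K a + Complex.I ^ (s : ℕ) • K b)ᴴ = (4 : ℝ) • (K a * X * (K a)ᴴ + K b * X * (K b)ᴴ) := by
      simp only [Fin.sum_univ_four, Fin.val_zero, Fin.val_one, Fin.val_two, pow_zero, pow_one,
        show ((3 : Fin 4) : ℕ) = 3 from rfl, Complex.I_sq, Complex.I_pow_three, one_smul,
        conjTranspose_add, conjTranspose_smul, Matrix.add_mul, Matrix.mul_add, Matrix.smul_mul,
        Matrix.mul_smul, smul_smul, smul_add, RCLike.star_def, map_neg, Complex.conj_I, map_one]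
      simp only [neg_mul, mul_neg, neg_neg, Complex.I_mul_I, neg_smul, one_smul]
      module
    have hs : (√(8 * Fintype.card κ : ℝ))⁻¹ * (√(8 * Fintype.card κ : ℝ))⁻¹ * 4 =
        (2 * Fintype.card κ : ℝ)⁻¹ := by
      rw [← mul_inv, Real.mul_self_sqrt (by positivity)]
      by_cases h : (Fintype.card κ : ℝ) = 0
      · simp [h]
      · field_simp; norm_num
    rw [← hs, mul_smul, ← h0, Finset.smul_sum]
    simp only [mixedKraus, conjTranspose_smul, Matrix.smul_mul, Matrix.mul_smul, smul_smul,
      star_trivial]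
  rw [krausMap_apply, krausMap_apply, Fintype.sum_prod_type]
  simp only [Fintype.sum_prod_type, h4, ← Finset.smul_sum, Finset.sum_add_distrib,
    Finset.sum_const, Finset.card_univ]
  rcases isEmpty_or_nonempty κ with h | h
  · simp
  · have : (Fintype.card κ : ℝ) ≠ 0 := by exact_mod_cast Fintype.card_ne_zero
    simp only [← Nat.cast_smul_eq_nsmul ℝ, ← two_smul ℝ, smul_smul]
    rw [show (2 * (Fintype.card κ : ℝ))⁻¹ * (2 * Fintype.card κ) = 1 by field_simp, one_smul]

/-- If every mixed Kraus operator preserves the Gram matrix of `M` up to a factor, then the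
original Kraus operators satisfy the Knill–Laflamme conditions on the range of `M`. -/
lemma exists_knillLaflamme_of_mixedKraus {β : Type*} [Fintype γ] (K : κ → Matrix γ α ℂ)
    (M : Matrix α β ℂ) (q : κ × κ × Fin 4 → ℂ)
    (h : ∀ x, (mixedKraus K x * M)ᴴ * (mixedKraus K x * M) = q x • (Mᴴ * M)) :
    ∃ c : Matrix κ κ ℂ, ∀ a b, (K a * M)ᴴ * (K b * M) = c a b • (Mᴴ * M) := by
  rcases isEmpty_or_nonempty κ with h0 | h0
  · exact ⟨0, fun a => isEmptyElim a⟩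
  have hκ : (8 * (Fintype.card κ : ℝ)) ≠ 0 := by
    have : (Fintype.card κ : ℝ) ≠ 0 := by exact_mod_cast Fintype.card_ne_zero
    positivity
  have h1 : ∀ a b (s : Fin 4), (K a * M + Complex.I ^ (s : ℕ) • (K b * M))ᴴ *
      (K a * M + Complex.I ^ (s : ℕ) • (K b * M)) =
      ((8 * (Fintype.card κ : ℝ) : ℝ) * q (a, b, s)) • (Mᴴ * M) := by
    intro a b s
    rw [mul_smul, ← h]
    simp only [mixedKraus, Matrix.smul_mul, Matrix.mul_smul, conjTranspose_smul, star_trivial,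
      smul_smul, Matrix.add_mul]
    rw [Complex.coe_smul, smul_smul, ← mul_inv, Real.mul_self_sqrt (by positivity),
      mul_inv_cancel₀ hκ, one_smul]
  -- The weights `star (I ^ s)` isolate the cross term of `K a` and `K b`; `8 |κ|` undoes the
  -- normalization.
  refine ⟨fun a b => 4⁻¹ * ∑ s : Fin 4, star (Complex.I ^ (s : ℕ)) *
    ((8 * (Fintype.card κ : ℝ) : ℝ) * q (a, b, s)), fun a b => ?_⟩
  simp only [mul_smul (4⁻¹ : ℂ), Finset.sum_smul, mul_smul (star _), ← h1]
  simp only [Fin.sum_univ_four, Fin.val_zero, Fin.val_one, Fin.val_two, pow_zero, pow_one,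
    show ((3 : Fin 4) : ℕ) = 3 from rfl, Complex.I_sq, Complex.I_pow_three, one_smul,
    conjTranspose_add, conjTranspose_smul, Matrix.add_mul, Matrix.mul_add, Matrix.smul_mul,
    Matrix.mul_smul, smul_smul, smul_add, RCLike.star_def, map_neg, Complex.conj_I, map_one]
  simp only [neg_mul, mul_neg, neg_neg, Complex.I_mul_I, neg_smul]
  module

end Mixing

/-! ### Uniform loss of linear entropy. -/

section Compactness

variable {α β : Type*} [Fintype α] [Fintype β]

lemma continuous_frobSq : Continuous (frobSq : Matrix α β ℂ → ℝ) := by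
  unfold frobSq
  exact continuous_finsetSum _ fun i _ => continuous_finsetSum _ fun j _ =>
    ((continuous_id.matrix_elem i j).norm.pow 2)

lemma isCompact_frobSq_eq_one : IsCompact {M : Matrix α β ℂ | frobSq M = 1} := by
  have hK : IsCompact (Set.univ.pi fun _ : α => Set.univ.pi fun _ : β =>
      Metric.closedBall (0 : ℂ) 1) :=
    isCompact_univ_pi fun _ => isCompact_univ_pi fun _ => isCompact_closedBall 0 1
  refine hK.of_isClosed_subset (isClosed_eq continuous_frobSq continuous_const) ?_
  intro M hM
  simp only [Set.mem_univ_pi, mem_closedBall_zero_iff]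
  intro i j
  have h1 : ‖M i j‖ ^ 2 ≤ frobSq M :=
    (Finset.single_le_sum (f := fun j => ‖M i j‖ ^ 2) (fun _ _ => by positivity)
      (Finset.mem_univ j)).trans
    (Finset.single_le_sum (f := fun i => ∑ j, ‖M i j‖ ^ 2)
      (fun _ _ => Finset.sum_nonneg fun _ _ => by positivity) (Finset.mem_univ i))
  rw [hM] at h1
  exact (sq_le_one_iff₀ (norm_nonneg _)).mp h1

open scoped MatrixOrder in
-- This trades Bob's system, of unbounded dimension, for a copy of Alice's, so that one compact set
-- serves every `b`.
lemma exists_square_gram_eq (M : Matrix α β ℂ) : ∃ N : Matrix α α ℂ, M * Mᴴ = N * Nᴴ := by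
  classical
  obtain ⟨Y, hY⟩ := CStarAlgebra.nonneg_iff_eq_star_mul_self.mp
    (Matrix.posSemidef_self_mul_conjTranspose M).nonneg
  exact ⟨Yᴴ, by rw [hY, conjTranspose_conjTranspose]; rfl⟩

/-- A channel without correctable subspaces destroys a fixed fraction of the excess of the linear
entropy over any given threshold. -/
lemma exists_sum_linEnt_mixedKraus_le {κ : Type*} [Fintype κ] [DecidableEq α]
    {K : κ → Matrix α α ℂ} (hK : ∑ a, (K a)ᴴ * K a = 1)
    (hΛ : ¬ HasCorrectableSubspace (krausMap K)) {ε : ℝ} (hε : 0 < ε) :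
    ∃ δ, 0 < δ ∧ δ ≤ 1 ∧ ∀ (b : ℕ) (M : Matrix α (Fin b) ℂ),
      ∑ x, linEnt (mixedKraus K x * M) ≤ linEnt M - δ * (linEnt M - ε * frobSq M) := by
  set L := mixedKraus K
  have hL : ∑ x, (L x)ᴴ * L x = 1 := by
    rw [← isTP_krausMap_iff, krausMap_mixedKraus, isTP_krausMap_iff, hK]
  let D : Matrix α α ℂ → ℝ := fun N =>
    ∑ x, frobSq (Nᴴ * ((L x)ᴴ * L x) * N - (frobSq (L x * N) : ℂ) • (Nᴴ * N))
  have hDc : Continuous D := by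
    refine continuous_finsetSum _ fun x _ => continuous_frobSq.comp ?_
    have h1 : Continuous fun N : Matrix α α ℂ => Nᴴ := continuous_id.matrix_conjTranspose
    have h2 : Continuous fun N : Matrix α α ℂ => frobSq (L x * N) :=
      continuous_frobSq.comp (continuous_const.matrix_mul continuous_id)
    exact ((h1.matrix_mul continuous_const).matrix_mul continuous_id).sub
      ((Complex.continuous_ofReal.comp h2).smul (h1.matrix_mul continuous_id))
  -- The threshold `ε` keeps `S` away from product vectors, on which no loss can be expected.
  let S : Set (Matrix α α ℂ) := {N | frobSq N = 1} ∩ {N | ε ≤ 1 - frobSq (N * Nᴴ)}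
  have hS : IsCompact S := by
    refine isCompact_frobSq_eq_one.inter_right (isClosed_le continuous_const ?_)
    exact continuous_const.sub (continuous_frobSq.comp
      (continuous_id.matrix_mul continuous_id.matrix_conjTranspose))
  have hD0 : ∀ N, 0 ≤ D N := fun N => Finset.sum_nonneg fun _ _ => frobSq_nonneg _
  have hlin : ∀ N : Matrix α α ℂ, frobSq N = 1 → linEnt N = 1 - frobSq (N * Nᴴ) := by
    intro N hN
    rw [linEnt, hN, div_one]
  have hDpos : ∀ N ∈ S, 0 < D N := by
    intro N hN
    refine (hD0 N).lt_of_ne' fun h => hΛ ?_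
    have h1 : linEnt N ≠ 0 := by
      rw [hlin N hN.1]
      exact (hε.trans_le hN.2).ne'
    have h2 := (Finset.sum_eq_zero_iff_of_nonneg fun x _ => frobSq_nonneg _).mp h
    obtain ⟨c, hc⟩ := exists_knillLaflamme_of_mixedKraus K N (fun x => (frobSq (L x * N) : ℂ))
      fun x => by
        have := frobSq_eq_zero.mp (h2 x (Finset.mem_univ x))
        rw [sub_eq_zero] at this
        rw [← this, conjTranspose_mul]
        simp only [Matrix.mul_assoc, L]
    exact hasCorrectableSubspace_of_knillLaflamme hK h1 hc
  obtain ⟨δ, hδ, hδ1, hδD⟩ : ∃ δ, 0 < δ ∧ δ ≤ 1 ∧ ∀ N ∈ S, δ ≤ D N := by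
    rcases S.eq_empty_or_nonempty with h | h
    · exact ⟨1, one_pos, le_rfl, by simp [h]⟩
    · obtain ⟨N, hN, hmin⟩ := hS.exists_isMinOn h hDc.continuousOn
      exact ⟨min (D N) 1, lt_min (hDpos N hN) one_pos, min_le_right _ _,
        fun N' hN' => (min_le_left _ _).trans (hmin hN')⟩
  have key : ∀ N : Matrix α α ℂ, frobSq N = 1 →
      ∑ x, linEnt (L x * N) ≤ linEnt N - δ * (linEnt N - ε) := by
    intro N hN
    have h1 := sum_linEnt_mul_add_le hL hN
    suffices δ * (linEnt N - ε) ≤ D N by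
      simp only [D] at this
      linarith
    have h3 := hlin N hN
    -- Above the threshold, `linEnt N ≤ 1` gives `δ * (linEnt N - ε) ≤ δ ≤ D N`. Below it the left
    -- side is not positive.
    by_cases h2 : ε ≤ linEnt N
    · have h4 := hδD N ⟨hN, h2.trans_eq h3⟩
      have h5 := frobSq_nonneg (N * Nᴴ)
      nlinarith
    · nlinarith [hD0 N]
  refine ⟨δ, hδ, hδ1, fun b M => ?_⟩
  obtain ⟨N, hN⟩ := exists_square_gram_eq M
  have h1 : ∀ x, linEnt (L x * M) = linEnt (L x * N) := fun x => linEnt_eq_of_gram_eq (by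
    rw [conjTranspose_mul, conjTranspose_mul, Matrix.mul_assoc, Matrix.mul_assoc,
      ← Matrix.mul_assoc M, ← Matrix.mul_assoc N, hN])
  have h2 : frobSq M = frobSq N := by rw [frobSq_eq_re_trace, hN, frobSq_eq_re_trace]
  simp only [h1, h2, linEnt_eq_of_gram_eq hN]
  by_cases hN0 : N = 0
  · simp [hN0]
  obtain ⟨c, N', rfl, hN', hc⟩ := exists_smul_frobSq_eq_one hN0
  simp only [Matrix.mul_smul, linEnt_smul, ← Finset.mul_sum, frobSq_smul, hN', mul_one]
  have := mul_le_mul_of_nonneg_left (key N' hN') (sq_nonneg ‖c‖)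
  linarith

end Compactness

/-! ### Decay of entanglement without a correctable subspace. -/

lemma not_sustainsEntanglement {d : ℕ} {Λ : Op (Fin d) →ₗ[ℂ] Op (Fin d)} (hΛ : IsChannel Λ)
    (h : ¬ HasCorrectableSubspace Λ) (B : ℕ → ℕ) : ¬ SustainsEntanglement Λ B := by
  rintro ⟨ρ, F, hρ, hF, c, hc, hlim⟩
  obtain ⟨m, K, rfl⟩ := hΛ.1.exists_krausMap
  have hK := isTP_krausMap_iff.mp hΛ.2
  set σ := repeated (krausMap K) B F ρ with hσ
  have htr : ∀ n, (σ n).trace = 1 := by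
    intro n
    induction n with
    | zero => exact hρ.2
    | succ n ih =>
      rw [hσ, repeated, isTP_ampLeft hΛ.2, (hF n).isTP]
      exact ih
  obtain ⟨C, hC, hE⟩ := exists_entanglementOfFormation_le (Fin d) (show 0 < c / 4 by positivity)
  -- Once the linear entropy is at most `2 * ε`, the entanglement of formation is at most `c / 4 + c
  -- / 4`.
  obtain ⟨ε, hε, hCε⟩ : ∃ ε, 0 < ε ∧ C * (2 * ε) ≤ c / 4 := by
    refine ⟨c / (8 * (C + 1)), by positivity, ?_⟩
    rw [mul_div_assoc', mul_div_assoc', div_le_iff₀ (by positivity)]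
    nlinarith
  obtain ⟨δ, hδ, hδ1, hmix⟩ := exists_sum_linEnt_mixedKraus_le hK h hε
  have hstep : ∀ n g, HasDecomp (σ n) g → HasDecomp (σ (n + 1)) (g - δ * (g - ε)) := by
    intro n g hg
    obtain ⟨ι, _, M, hM, hMg⟩ := (hF n).hasDecomp hg
    have hM1 : ∑ i, frobSq (M i) = 1 := by
      have h1 := congrArg Matrix.trace hM
      rw [(hF n).isTP, htr, Matrix.trace_sum] at h1
      simp only [trace_ketbra_toVec] at h1
      exact_mod_cast h1
    have hnext : σ (n + 1) = ∑ i, ∑ x, ketbra (toVec (mixedKraus K x * M i)) := by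
      rw [hσ, repeated, ← hσ, ← hM, map_sum]
      refine Finset.sum_congr rfl fun i _ => ?_
      rw [← krausMap_mixedKraus, krausMap_ketbra_toVec_left]
    rw [hnext]
    refine (HasDecomp.sum fun i => HasDecomp.sum fun x => hasDecomp_ketbra _).mono ?_
    refine (Finset.sum_le_sum fun i _ => hmix _ (M i)).trans ?_
    rw [Finset.sum_sub_distrib, ← Finset.mul_sum, Finset.sum_sub_distrib, ← Finset.mul_sum, hM1]
    -- The actual total is only known to be at most `g`; as `δ ≤ 1`, the map `t ↦ t - δ * (t - ε)`
    -- is monotone.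
    nlinarith [mul_nonneg (sub_nonneg.mpr hδ1) (sub_nonneg.mpr hMg)]
  obtain ⟨g, hg⟩ := hρ.exists_hasDecomp
  -- From a bound of at least `2 * ε`, each step gains at least `δ * ε`. The target is `2 * ε`
  -- because the gain vanishes at `ε`.
  have hdec : ∀ n : ℕ, HasDecomp (σ n) (max (g - n * (δ * ε)) (2 * ε)) := by
    intro n
    induction n with
    | zero => exact hg.mono (by simp)
    | succ n ih =>
      refine (hstep n _ ih).mono ?_
      have h2 : 2 * ε ≤ max (g - n * (δ * ε)) (2 * ε) := le_max_right _ _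
      set t := max (g - n * (δ * ε)) (2 * ε) with ht
      have h3 : t - δ * (t - ε) ≤ t - δ * ε := by nlinarith
      refine h3.trans ?_
      rw [sub_le_iff_le_add, ht]
      refine max_le ?_ ?_
      · have := le_max_left (g - ((n + 1 : ℕ) : ℝ) * (δ * ε)) (2 * ε)
        push_cast at this ⊢
        linarith
      · have := le_max_right (g - ((n + 1 : ℕ) : ℝ) * (δ * ε)) (2 * ε)
        have := mul_pos hδ hε
        linarith
  have hev : ∀ᶠ n in atTop, entanglementOfFormation (σ n) ≤ c / 2 := by
    obtain ⟨n₀, hn₀⟩ := exists_nat_ge (g / (δ * ε))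
    filter_upwards [eventually_ge_atTop n₀] with n hn
    refine (hE _ (σ n) (2 * ε) (htr n) ((hdec n).mono (max_le ?_ le_rfl))).trans (by linarith)
    have h1 : g ≤ n * (δ * ε) := by
      rw [← div_le_iff₀ (mul_pos hδ hε)]
      exact hn₀.trans (by exact_mod_cast hn)
    linarith
  have := le_of_tendsto hlim hev
  linarith

end QInfo

end

theorem theorem2 {d : ℕ} (Λ : QInfo.Op (Fin d) →ₗ[ℂ] QInfo.Op (Fin d))
    (hΛ : QInfo.IsChannel Λ) :
    List.TFAE [
      (∃ b : ℕ, QInfo.SustainsEntanglement Λ (fun _ => b)),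
      (∃ B : ℕ → ℕ, QInfo.SustainsEntanglement Λ B),
      QInfo.HasCorrectableSubspace Λ] := by
  tfae_have 1 → 2 := fun ⟨b, hb⟩ => ⟨fun _ => b, hb⟩
  tfae_have 2 → 3 := fun ⟨B, hB⟩ => by
    by_contra h
    exact QInfo.not_sustainsEntanglement hΛ h B hB
  tfae_have 3 → 1 := fun h => ⟨2, h.sustainsEntanglement hΛ⟩
  tfae_finish
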